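/- Let $(\mathsf X,\mathcal F_{\mathsf X})$ and $(\mathsf Y,\mathcal F_{\mathsf Y})$ be measurable spaces with countably generated $\sigma$-fields (e.g. Polish spaces with their Borel $\sigma$-fields), let $\mu,\tilde\mu$ be probability measures on $\mathsf X$ and $\nu,\tilde\nu$ probability measures on $\mathsf Y$ with $\mu\sim\tilde\mu$, $\nu\sim\tilde\nu$ (mutually absolutely continuous) and $$\tfrac{d\mu}{d\tilde\mu}\in L^2(\tilde\mu),\quad \bigl(\tfrac{d\mu}{d\tilde\mu}\bigr)^{-1}\in L^\infty(\tilde\mu),\quad \tfrac{d\nu}{d\tilde\nu}\in L^2(\tilde\nu),\quad \bigl(\tfrac{d\nu}{d\tilde\nu}\bigr)^{-1}\in L^\infty(\tilde\nu).$$ Put $P:=\tilde\mu\otimes\tilde\nu$ and write $(f\oplus g)(x,y):=f(x)+g(y)$. Let $c:\mathsf X\times\mathsf Y\to\mathbb R$ be in $L^2(P)$ and satisfy $c\ge c_1\oplus c_2$ $P$-a.s. for some $c_1\in L^1(\mu)\cap L^1(\tilde\mu)$ and $c_2\in L^1(\nu)\cap L^1(\tilde\nu)$. Let $\Pi(\mu,\nu)$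 be the set of couplings of $\mu$ and $\nu$, i.e. measures on $\mathsf X\times\mathsf Y$ with marginals $\mu$ and $\nu$, and let $\mathcal Z:=\{Z\in L^2(P): Z\,dP\in\Pi(\mu,\nu)\}$. Consider the regularized transport problem $$\inf_{\pi\in\Pi(\mu,\nu)}\ \int c\,d\pi+\tfrac12\Bigl\|\tfrac{d\pi}{dP}\Bigr\|_{L^2(P)}^2\qquad(\text{with value }+\infty\text{ for }\pi\not\ll P),\tag{QOT}$$ the primal problem $\mathscr P:=\inf_{Z\in\mathcal Z}\int cZ\,dP+\tfrac12\|Z\|^2_{L^2(P)}$ and the dual problem $$\mathscr D:=\sup_{f\in L^1(\mu),\,g\in L^1(\nu)}\int f\,d\mu+\int g\,d\nu-\tfrac12\int(f\oplus g-c)_+^2\,dP.$$ (i) Strong duality holds: $\mathscr P=\mathscr D\in\mathbb R$. (ii) The primal problem has a unique solution $Z_*\in\mathcal Z$. It is the $L^2(P)$-projection of $-c$ onto $\mathcal Z$, that is, the unique minimizer of $\|Z+c\|_{L^2(P)}^2$ over $Z\in\mathcal Z$, and it is the unique element of $\mathcal Z$ with $\langle Z_*+c,Z-Z_*\rangle_{L^2(P)}\ge0$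 for all $Z\in\mathcal Z$. The coupling $\pi_*$ given by $d\pi_*=Z_*\,dP$ is the unique solution of (QOT). (iii) There exist measurable functions $f:\mathsf X\to\mathbb R$ and $g:\mathsf Y\to\mathbb R$ satisfying the following conditions (a)–(d), and for any measurable $f:\mathsf X\to\mathbb R$, $g:\mathsf Y\to\mathbb R$ these conditions are equivalent: (a) $(f\oplus g-c)_+=Z_*$ $P$-a.s.; (b) $(f\oplus g-c)_+$ is the $P$-density of some coupling $\pi\in\Pi(\mu,\nu)$; (c) $(f,g)\in L^1(\mu)\times L^1(\nu)$ and $(f,g)$ attains the supremum in the dual problem; (d) $\int_{\mathsf X}(f(x)+g(y)-c(x,y))_+\,\tilde\mu(dx)=\frac{d\nu}{d\tilde\nu}(y)$ for $\tilde\nu$-a.e. $y\in\mathsf Y$, and $\int_{\mathsf Y}(f(x)+g(y)-c(x,y))_+\,\tilde\nu(dy)=\frac{d\mu}{d\tilde\mu}(x)$ for $\tilde\mu$-a.e. $x\in\mathsf X$. In particular, any such $(f,g)$ (called potentials) belongs to $L^1(\mu)\times L^1(\nu)$. (iv) Suppose that $(\mathsf X,\mu,\tilde\mu)=(\mathsf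 Y,\nu,\tilde\nu)$ and $c(x,y)=c(y,x)$ for $P$-a.e. $(x,y)$. Then there is a measurable $f:\mathsf X\to\mathbb R$ such that $(f,f)$ satisfies (a)–(d), and the dual problem has the same value $\mathscr D$ if the supremum is restricted to pairs with $f=g$. -/

import Mathlib

open MeasureTheory
open scoped ENNReal

namespace QuadOT

/-- The set `Π(μ, ν)` of couplings of `μ` and `ν`. -/
def couplings {X Y : Type*} [MeasurableSpace X] [MeasurableSpace Y]
    (μ : Measure X) (ν : Measure Y) : Set (Measure (X × Y)) :=
  {π | (∀ A, MeasurableSet A → π (A ×ˢ Set.univ) = μ A) ∧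
    (∀ B, MeasurableSet B → π (Set.univ ×ˢ B) = ν B)}

/-- Conditions on a marginal `μ` and its reference measure `μ₀`: they are equivalent measures,
`dμ/dμ₀ ∈ L²(μ₀)` and `(dμ/dμ₀)⁻¹ ∈ L^∞(μ₀)`. -/
structure IsReference {X : Type*} [MeasurableSpace X] (μ μ₀ : Measure X) : Prop where
  ac : μ ≪ μ₀
  ca : μ₀ ≪ μ
  density_memLp : MemLp (fun x => (μ.rnDeriv μ₀ x).toReal) 2 μ₀
  inv_density_memLp : MemLp (fun x => ((μ.rnDeriv μ₀ x).toReal)⁻¹) ∞ μ₀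

/-- Conditions on the cost: `c ∈ L²(P)` for `P = μ₀ ⊗ ν₀`, and `c ≥ c₁ ⊕ c₂` for some
`c₁ ∈ L¹(μ) ∩ L¹(μ₀)` and `c₂ ∈ L¹(ν) ∩ L¹(ν₀)`. -/
structure IsCost {X Y : Type*} [MeasurableSpace X] [MeasurableSpace Y]
    (μ μ₀ : Measure X) (ν ν₀ : Measure Y) (c : X × Y → ℝ) : Prop where
  memLp : MemLp c 2 (μ₀.prod ν₀)
  lower_bound : ∃ (c₁ : X → ℝ) (c₂ : Y → ℝ),
    Integrable c₁ μ ∧ Integrable c₁ μ₀ ∧ Integrable c₂ ν ∧ Integrable c₂ ν₀ ∧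
    ∀ᵐ p ∂(μ₀.prod ν₀), c₁ p.1 + c₂ p.2 ≤ c p

section Problems

variable {X Y : Type*} [MeasurableSpace X] [MeasurableSpace Y]

/-- The integral `∫ c dπ` as an extended real number (positive part minus negative part). -/
noncomputable def extIntegral (c : X × Y → ℝ) (π : Measure (X × Y)) : EReal :=
  ((∫⁻ p, ENNReal.ofReal (c p) ∂π : ℝ≥0∞) : EReal)
    - ((∫⁻ p, ENNReal.ofReal (-c p) ∂π : ℝ≥0∞) : EReal)

open Classical in
/-- The functional `∫ c dπ + ½ ‖dπ/dP‖²_{L²(P)}`, equal to `∞` if `π` is not absolutely continuous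
with respect to `P = μ₀ ⊗ ν₀`. -/
noncomputable def qotCost (μ₀ : Measure X) (ν₀ : Measure Y) (c : X × Y → ℝ)
    (π : Measure (X × Y)) : EReal :=
  if π ≪ μ₀.prod ν₀ then
    extIntegral c π
      + ((1 / 2 * ∫⁻ p, (π.rnDeriv (μ₀.prod ν₀) p) ^ 2 ∂(μ₀.prod ν₀) : ℝ≥0∞) : EReal)
  else ⊤

/-- `π` solves the quadratically regularized optimal transport problem. -/
def IsQOTSolution (μ μ₀ : Measure X) (ν ν₀ : Measure Y) (c : X × Y → ℝ)
    (π : Measure (X × Y)) : Prop :=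
  π ∈ couplings μ ν ∧ ∀ π' ∈ couplings μ ν, qotCost μ₀ ν₀ c π ≤ qotCost μ₀ ν₀ c π'

/-- The measure `Z dP`, for nonnegative `Z`. -/
noncomputable def densityMeasure (μ₀ : Measure X) (ν₀ : Measure Y) (Z : X × Y → ℝ) :
    Measure (X × Y) :=
  (μ₀.prod ν₀).withDensity (fun p => ENNReal.ofReal (Z p))

/-- The set `𝒵 ⊆ L²(P)` of square-integrable densities of couplings of `μ` and `ν`. -/
def couplingDensities (μ μ₀ : Measure X) (ν ν₀ : Measure Y) : Set (Lp ℝ 2 (μ₀.prod ν₀)) :=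
  {Z | (∀ᵐ p ∂(μ₀.prod ν₀), 0 ≤ Z p) ∧ densityMeasure μ₀ ν₀ Z ∈ couplings μ ν}

/-- The primal functional `∫ c Z dP + ½ ‖Z‖²`. -/
noncomputable def primalObj (μ₀ : Measure X) (ν₀ : Measure Y) (c : X × Y → ℝ)
    (Z : Lp ℝ 2 (μ₀.prod ν₀)) : ℝ :=
  (∫ p, c p * Z p ∂(μ₀.prod ν₀)) + 1 / 2 * ‖Z‖ ^ 2

/-- The primal value `𝒫`, as an infimum in the extended reals. -/
noncomputable def primalValue (μ μ₀ : Measure X) (ν ν₀ : Measure Y) (c : X × Y → ℝ) : EReal :=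
  ⨅ Z ∈ couplingDensities μ μ₀ ν ν₀, (primalObj μ₀ ν₀ c Z : EReal)

/-- `Z` solves the primal problem. -/
def IsPrimalSolution (μ μ₀ : Measure X) (ν ν₀ : Measure Y) (c : X × Y → ℝ)
    (Z : Lp ℝ 2 (μ₀.prod ν₀)) : Prop :=
  Z ∈ couplingDensities μ μ₀ ν ν₀ ∧
    ∀ Z' ∈ couplingDensities μ μ₀ ν ν₀, primalObj μ₀ ν₀ c Z ≤ primalObj μ₀ ν₀ c Z'

/-- The function `(f ⊕ g - c)₊`. -/
noncomputable def posPartSum (c : X × Y → ℝ) (f : X → ℝ) (g : Y → ℝ) (p : X × Y) : ℝ :=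
  max (f p.1 + g p.2 - c p) 0

/-- The dual functional `∫ f dμ + ∫ g dν - ½ ∫ (f ⊕ g - c)₊² dP`, for `f ∈ L¹(μ)` and `g ∈ L¹(ν)`;
it equals `-∞` if `(f ⊕ g - c)₊` is not square-integrable. -/
noncomputable def dualObj (μ μ₀ : Measure X) (ν ν₀ : Measure Y) (c : X × Y → ℝ)
    (f : X → ℝ) (g : Y → ℝ) : EReal :=
  (((∫ x, f x ∂μ) + ∫ y, g y ∂ν : ℝ) : EReal)
    - ((1 / 2 * ∫⁻ p, ENNReal.ofReal (posPartSum c f g p ^ 2) ∂(μ₀.prod ν₀) : ℝ≥0∞) : EReal)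

/-- The dual value `𝒟`, as a supremum in the extended reals. -/
noncomputable def dualValue (μ μ₀ : Measure X) (ν ν₀ : Measure Y) (c : X × Y → ℝ) : EReal :=
  ⨆ (f : X → ℝ) (g : Y → ℝ) (_ : Integrable f μ) (_ : Integrable g ν), dualObj μ μ₀ ν ν₀ c f g

/-- `(f ⊕ g - c)₊` is (a version of) the optimal density. -/
def IsOptimalDensity (μ μ₀ : Measure X) (ν ν₀ : Measure Y) (c : X × Y → ℝ)
    (f : X → ℝ) (g : Y → ℝ) : Prop :=
  ∃ Z, IsPrimalSolution μ μ₀ ν ν₀ c Z ∧ posPartSum c f g =ᵐ[μ₀.prod ν₀] Z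

/-- `(f ⊕ g - c)₊` is the density of some coupling. -/
def IsCouplingDensity (μ μ₀ : Measure X) (ν ν₀ : Measure Y) (c : X × Y → ℝ)
    (f : X → ℝ) (g : Y → ℝ) : Prop :=
  ∃ π ∈ couplings μ ν, π = densityMeasure μ₀ ν₀ (posPartSum c f g)

/-- `(f, g) ∈ L¹(μ) × L¹(ν)` solves the dual problem. -/
def IsDualSolution (μ μ₀ : Measure X) (ν ν₀ : Measure Y) (c : X × Y → ℝ)
    (f : X → ℝ) (g : Y → ℝ) : Prop :=
  Integrable f μ ∧ Integrable g ν ∧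
    ∀ (f' : X → ℝ) (g' : Y → ℝ), Integrable f' μ → Integrable g' ν →
      dualObj μ μ₀ ν ν₀ c f' g' ≤ dualObj μ μ₀ ν ν₀ c f g

/-- `(f, g)` solves the system of marginal equations. -/
def SolvesMarginalSystem (μ μ₀ : Measure X) (ν ν₀ : Measure Y) (c : X × Y → ℝ)
    (f : X → ℝ) (g : Y → ℝ) : Prop :=
  (∀ᵐ y ∂ν₀, ∫⁻ x, ENNReal.ofReal (posPartSum c f g (x, y)) ∂μ₀ = ν.rnDeriv ν₀ y) ∧
    (∀ᵐ x ∂μ₀, ∫⁻ y, ENNReal.ofReal (posPartSum c f g (x, y)) ∂ν₀ = μ.rnDeriv μ₀ x)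

end Problems

end QuadOT

/-!
Write `P = μ₀ ⊗ ν₀` and `U = (f ⊕ g - c)₊`. The proof starts from the dual problem and obtains the
primal solution from it.

*The dual supremum is attained* (`exists_isDualSolution`). Let `z` be the density of `μ ⊗ ν`. With
`u = f ⊕ g - c`, the dual functional is, up to a constant, `∫ (u z - ½ u₊²) dP`. The integrand is
concave in `u`, bounded above by `½ z²`, and coercive: `|u| z ≤ 2 z² - (u z - ½ u₊²)`. As `z` is
bounded away from zero, near-maximizers are bounded in `L¹(P)`. Nested midpoint convex `L¹`-bounded
sets admit an almost everywhere convergent selection (`exists_seq_tendsto_ae_of_antitone`, a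
substitute for Komlós' theorem, obtained by nearly minimizing `∫ √(1 + u²)`); the limit is again of
the form `f ⊕ g - c` (`exists_tendsto_add`), and reverse Fatou shows that it is a maximizer
(`dualIntegrand_limit`).

*Maximizers are coupling densities* (`IsDualSolution.isCouplingDensity`). The derivative of the dual
functional in the directions `1_A ⊕ 0` and `0 ⊕ 1_B` vanishes, so `U dP` has the marginals `μ`
and `ν`.

*Coupling densities are optimal* (`IsCouplingDensity.integrability`,
`IsCouplingDensity.variational`). If `U dP` is a coupling, then `U ∈ L²(P)` and `f`, `g` are
integrable. Since `U + c ≥ f ⊕ g` with equality where `U > 0`, and `∫ (f ⊕ g) Z dP` does not depend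
on the coupling density `Z`, the class of `U` solves the variational inequality of the primal
problem, and the dual value of `(f, g)` equals the primal value of `U`. The variational inequality
has at most one solution and characterizes the minimizer. This gives strong duality, the statements
about the primal problem, and the equivalent descriptions of potentials; the marginal system is
Tonelli's theorem. A coupling of finite regularized cost has a density in `L²(P)`
(`qotCost_eq_top_or`), which reduces the transport problem to the primal problem.

*Self-transport* (`IsDualSolution.symmetrize`). For symmetric `c` the pair `(g, f)` is a maximizer
along with `(f, g)`, and by concavity so is the pair with both components `(f + g) / 2`.
-/

namespace QuadOT

open Filter Topology

/-! ### Almost everywhere convergence in nested convex sets -/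

/-- Quantitative strict convexity of `t ↦ √(1 + t²)`, which unlike `t²` is integrable along
integrable functions. -/
lemma sq_sub_le_sqrt_gap (a b : ℝ) :
    (a - b) ^ 2 ≤ (√(1 + a ^ 2) + √(1 + b ^ 2) - 2 * √(1 + ((a + b) / 2) ^ 2)) *
      (√(1 + a ^ 2) + √(1 + b ^ 2)) ^ 3 := by
  have hA := Real.sq_sqrt (show 0 ≤ 1 + a ^ 2 by positivity)
  have hB := Real.sq_sqrt (show 0 ≤ 1 + b ^ 2 by positivity)
  have hS := Real.sq_sqrt (show 0 ≤ 1 + ((a + b) / 2) ^ 2 by positivity)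
  have hA0 : 0 < √(1 + a ^ 2) := by positivity
  have hB0 : 0 < √(1 + b ^ 2) := by positivity
  have hS0 : 0 < √(1 + ((a + b) / 2) ^ 2) := by positivity
  generalize √(1 + a ^ 2) = A at *
  generalize √(1 + b ^ 2) = B at *
  generalize √(1 + ((a + b) / 2) ^ 2) = S at *
  have hprod : (A * B) ^ 2 = (1 + a * b) ^ 2 + (a - b) ^ 2 := by
    rw [mul_pow, hA, hB]; ring
  have hAB : 1 + a * b ≤ A * B :=
    le_of_sq_le_sq (by rw [hprod]; nlinarith [sq_nonneg (a - b)]) (by positivity)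
  have hfac : 2 * (A * B - 1 - a * b) = (A + B - 2 * S) * (A + B + 2 * S) := by
    linear_combination (-1 : ℝ) * hA - hB + 4 * hS
  have hgap : 0 ≤ A + B - 2 * S := by
    by_contra h
    have : (A + B - 2 * S) * (A + B + 2 * S) < 0 :=
      mul_neg_of_neg_of_pos (not_le.1 h) (by positivity)
    linarith
  calc (a - b) ^ 2 = (A * B - 1 - a * b) * (A * B + 1 + a * b) := by linear_combination -hprod
    _ ≤ (A * B - 1 - a * b) * (2 * (A * B)) := by
        apply mul_le_mul_of_nonneg_left <;> linarith
    _ = (A + B - 2 * S) * ((A + B + 2 * S) * (A * B)) := by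
        linear_combination (A * B) * hfac
    _ ≤ (A + B - 2 * S) * (A + B) ^ 3 := by
        apply mul_le_mul_of_nonneg_left _ hgap
        have h1 : A + B + 2 * S ≤ 2 * (A + B) := by linarith
        have h2 : 2 * (A * B) ≤ (A + B) ^ 2 := by nlinarith
        calc (A + B + 2 * S) * (A * B) ≤ 2 * (A + B) * (A * B) := by gcongr
          _ = (A + B) * (2 * (A * B)) := by ring
          _ ≤ (A + B) * (A + B) ^ 2 := by gcongr
          _ = (A + B) ^ 3 := by ring

/-- Young's inequality for the exponents `1/4` and `3/4`. -/
lemma le_add_of_pow_four_le {r G W ε : ℝ} (hG : 0 ≤ G) (hW : 0 ≤ W) (hε : 0 < ε)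
    (h : r ^ 4 ≤ G * W ^ 3) : r ≤ ε * W + G / ε ^ 3 := by
  by_contra! hr
  have h1 : ε * W < r := lt_of_le_of_lt (by have : 0 ≤ G / ε ^ 3 := by positivity
                                            linarith) hr
  have h2 : G / ε ^ 3 < r := lt_of_le_of_lt (by have : 0 ≤ ε * W := by positivity
                                                linarith) hr
  have h3 : (ε * W) ^ 3 ≤ r ^ 3 := by gcongr
  have hr0 : 0 < r := lt_of_le_of_lt (by positivity) h1
  have h4 : G < r * ε ^ 3 := by rwa [div_lt_iff₀ (by positivity)] at h2
  rcases hW.eq_or_lt with rfl | hW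
  · have : 0 < r ^ 4 := by positivity
    simp at h
    linarith
  · have : G * W ^ 3 < r * ε ^ 3 * W ^ 3 := by gcongr
    have : r * (ε * W) ^ 3 ≤ r * r ^ 3 := by gcongr
    nlinarith

/-- The distance of two points is controlled by the convexity gap at their midpoint and, with a small
factor, by their size. The square root makes both terms on the right integrable for `a`, `b` in
`L¹`. -/
lemma sqrt_abs_sub_le (a b : ℝ) {ε : ℝ} (hε : 0 < ε) :
    √|a - b| ≤ ε * (√(1 + a ^ 2) + √(1 + b ^ 2)) +
      (√(1 + a ^ 2) + √(1 + b ^ 2) - 2 * √(1 + ((a + b) / 2) ^ 2)) / ε ^ 3 := by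
  have h := sq_sub_le_sqrt_gap a b
  refine le_add_of_pow_four_le ?_ (by positivity) hε ?_
  · have hpos : 0 < (√(1 + a ^ 2) + √(1 + b ^ 2)) ^ 3 := by positivity
    exact nonneg_of_mul_nonneg_left ((sq_nonneg _).trans h) hpos
  · calc √|a - b| ^ 4 = (√|a - b| ^ 2) ^ 2 := by ring
      _ = (a - b) ^ 2 := by rw [Real.sq_sqrt (abs_nonneg _), sq_abs]
      _ ≤ _ := h

lemma sqrt_one_add_sq_le (t : ℝ) : √(1 + t ^ 2) ≤ 1 + |t| := by
  rw [Real.sqrt_le_left (by positivity)]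
  nlinarith [abs_nonneg t, sq_abs t]

lemma integrable_sqrt_one_add_sq {Ω : Type*} [MeasurableSpace Ω] {P : Measure Ω}
    [IsFiniteMeasure P] {u : Ω → ℝ} (hu : Integrable u P) :
    Integrable (fun ω => √(1 + u ω ^ 2)) P := by
  refine Integrable.mono' ((integrable_const (1 : ℝ)).add hu.abs) ?_ ?_
  · exact (Real.continuous_sqrt.comp (by fun_prop : Continuous fun t : ℝ => 1 + t ^ 2)
      ).comp_aestronglyMeasurable hu.1
  · refine Eventually.of_forall fun ω => ?_
    rw [Real.norm_of_nonneg (Real.sqrt_nonneg _)]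
    exact sqrt_one_add_sq_le _

lemma exists_tendsto_of_summable_sqrt {x : ℕ → ℝ}
    (h : Summable fun n => √|x n - x (n + 1)|) : ∃ l, Tendsto x atTop (𝓝 l) := by
  apply cauchySeq_tendsto_of_complete
  apply cauchySeq_of_summable_dist
  have h0 : ∀ᶠ n in atTop, √|x n - x (n + 1)| ≤ 1 :=
    h.tendsto_atTop_zero.eventually_le_const one_pos
  refine Summable.of_norm_bounded_eventually_nat h ?_
  filter_upwards [h0] with n hn
  rw [Real.norm_of_nonneg dist_nonneg, Real.dist_eq]
  calc |x n - x (n + 1)| = √|x n - x (n + 1)| * √|x n - x (n + 1)| :=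
        (Real.mul_self_sqrt (abs_nonneg _)).symm
    _ ≤ √|x n - x (n + 1)| * 1 := by gcongr
    _ = _ := mul_one _

/-- A decreasing sequence of nonempty, midpoint convex, `L¹`-bounded sets of functions admits a
selection that converges almost everywhere. The selection nearly minimizes the strictly convex
functional `u ↦ ∫ √(1 + u²)`, which makes it Cauchy. -/
theorem exists_seq_tendsto_ae_of_antitone {Ω : Type*} [MeasurableSpace Ω] {P : Measure Ω}
    [IsProbabilityMeasure P] {K : ℕ → Set (Ω → ℝ)} (hK : Antitone K)
    (hne : ∀ n, (K n).Nonempty)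
    (hmid : ∀ n, ∀ u ∈ K n, ∀ v ∈ K n, (fun ω => (u ω + v ω) / 2) ∈ K n) {C : ℝ}
    (hint : ∀ n, ∀ u ∈ K n, Integrable u P ∧ ∫ ω, |u ω| ∂P ≤ C) :
    ∃ u : ℕ → Ω → ℝ, (∀ n, u n ∈ K n) ∧
      ∀ᵐ ω ∂P, ∃ l, Tendsto (fun n => u n ω) atTop (𝓝 l) := by
  set Ψ : (Ω → ℝ) → ℝ := fun u => ∫ ω, √(1 + u ω ^ 2) ∂P with hΨ
  have hΨi : ∀ n, ∀ u ∈ K n, Integrable (fun ω => √(1 + u ω ^ 2)) P :=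
    fun n u hu => integrable_sqrt_one_add_sq (hint n u hu).1
  have hΨle : ∀ n, ∀ u ∈ K n, Ψ u ≤ 1 + C := by
    intro n u hu
    calc Ψ u ≤ ∫ ω, (1 + |u ω|) ∂P := by
          refine integral_mono (hΨi n u hu)
            ((integrable_const (1 : ℝ)).add (hint n u hu).1.abs) fun ω => sqrt_one_add_sq_le _
      _ = 1 + ∫ ω, |u ω| ∂P := by
          rw [integral_add (integrable_const _) (hint n u hu).1.abs]; simp
      _ ≤ 1 + C := by gcongr; exact (hint n u hu).2
  have hΨ0 : ∀ u, 0 ≤ Ψ u := fun u => integral_nonneg fun ω => Real.sqrt_nonneg _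
  set J : ℕ → ℝ := fun n => sInf (Ψ '' K n) with hJ
  have hbdd : ∀ n, BddBelow (Ψ '' K n) := fun n => ⟨0, by rintro _ ⟨u, -, rfl⟩; exact hΨ0 u⟩
  have hJmono : Monotone J := fun m n hmn =>
    csInf_le_csInf (hbdd m) ((hne n).image _) (Set.image_mono (hK hmn))
  have hJle : ∀ n, J n ≤ 1 + C := by
    intro n
    obtain ⟨u, hu⟩ := hne n
    exact (csInf_le (hbdd n) ⟨u, hu, rfl⟩).trans (hΨle n u hu)
  have hJbdd : BddAbove (Set.range J) := ⟨1 + C, by rintro _ ⟨n, rfl⟩; exact hJle n⟩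
  have hJlim := tendsto_atTop_ciSup hJmono hJbdd
  set L := ⨆ n, J n
  -- values within `ε n ^ 4` of the limiting infimum `L` make the convexity gap between successive
  -- terms `O(ε n ^ 4)`, so that both summands in `sqrt_abs_sub_le` integrate to `O(ε n)`
  set ε : ℕ → ℝ := fun n => (1 / 2) ^ n with hε
  have hεpos : ∀ n, 0 < ε n := fun n => by positivity
  obtain ⟨φ, hφ, hφJ⟩ := extraction_forall_of_eventually (P := fun n N => L - ε n ^ 4 < J N)
    (fun n => hJlim.eventually_const_lt (by linarith [pow_pos (hεpos n) 4]))
  have hsel : ∀ n, ∃ u ∈ K (φ n), Ψ u < L + ε n ^ 4 := by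
    intro n
    obtain ⟨_, ⟨u, hu, rfl⟩, hlt⟩ := exists_lt_of_csInf_lt ((hne (φ n)).image Ψ)
      (show J (φ n) < L + ε n ^ 4 by
        linarith [le_ciSup hJbdd (φ n), pow_pos (hεpos n) 4])
    exact ⟨u, hu, hlt⟩
  choose u huK huΨ using hsel
  refine ⟨u, fun n => hK (hφ.id_le n) (huK n), ?_⟩
  have huK' : ∀ n, u (n + 1) ∈ K (φ n) := fun n => hK (hφ.monotone n.le_succ) (huK (n + 1))
  -- the integrable majorant of `√|u n - u (n + 1)|`
  set B : ℕ → Ω → ℝ := fun n ω => ε n * (√(1 + u n ω ^ 2) + √(1 + u (n + 1) ω ^ 2)) +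
      (√(1 + u n ω ^ 2) + √(1 + u (n + 1) ω ^ 2)
        - 2 * √(1 + ((u n ω + u (n + 1) ω) / 2) ^ 2)) / ε n ^ 3 with hB
  have hle : ∀ n ω, √|u n ω - u (n + 1) ω| ≤ B n ω := fun n ω => sqrt_abs_sub_le _ _ (hεpos n)
  have hBint : ∀ n, Integrable (B n) P := by
    intro n
    have h1 := hΨi _ _ (huK n)
    have h2 := hΨi _ _ (huK' n)
    have h3 := hΨi _ _ (hmid _ _ (huK n) _ (huK' n))
    exact ((h1.add h2).const_mul _).add (((h1.add h2).sub (h3.const_mul 2)).div_const _)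
  have hBval : ∀ n, ∫ ω, B n ω ∂P ≤ ε n * (2 * (1 + C) + 4) := by
    intro n
    have h1 := hΨi _ _ (huK n)
    have h2 := hΨi _ _ (huK' n)
    have h3 := hΨi _ _ (hmid _ _ (huK n) _ (huK' n))
    have hval : ∫ ω, B n ω ∂P = ε n * (Ψ (u n) + Ψ (u (n + 1))) + (Ψ (u n) + Ψ (u (n + 1))
        - 2 * Ψ (fun ω => (u n ω + u (n + 1) ω) / 2)) / ε n ^ 3 := by
      simp only [hB, hΨ]
      have h12 : Integrable (fun ω => √(1 + u n ω ^ 2) + √(1 + u (n + 1) ω ^ 2)) P := h1.add h2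
      have h123 : Integrable (fun ω => √(1 + u n ω ^ 2) + √(1 + u (n + 1) ω ^ 2)
          - 2 * √(1 + ((u n ω + u (n + 1) ω) / 2) ^ 2)) P := h12.sub (h3.const_mul 2)
      rw [integral_add (h12.const_mul _) (h123.div_const _), integral_const_mul, integral_div,
        integral_sub h12 (h3.const_mul 2), integral_add h1 h2, integral_const_mul]
    have hlow : L - ε n ^ 4 < Ψ (fun ω => (u n ω + u (n + 1) ω) / 2) :=
      (hφJ n).trans_le (csInf_le (hbdd _) ⟨_, hmid _ _ (huK n) _ (huK' n), rfl⟩)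
    have hε' : ε (n + 1) ^ 4 ≤ ε n ^ 4 := by
      have : ε (n + 1) ≤ ε n := pow_le_pow_of_le_one (by norm_num) (by norm_num) n.le_succ
      have := (hεpos (n + 1)).le
      gcongr
    rw [hval, mul_add (ε n)]
    have e1 : Ψ (u n) + Ψ (u (n + 1)) ≤ 2 * (1 + C) := by
      linarith [hΨle _ _ (huK n), hΨle _ _ (huK' n)]
    have e2 : (Ψ (u n) + Ψ (u (n + 1))
        - 2 * Ψ (fun ω => (u n ω + u (n + 1) ω) / 2)) / ε n ^ 3 ≤ ε n * 4 := by
      rw [div_le_iff₀ (pow_pos (hεpos n) 3)]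
      have := huΨ n
      have := huΨ (n + 1)
      nlinarith
    rw [← mul_add]
    calc _ ≤ ε n * (2 * (1 + C)) + ε n * 4 :=
          add_le_add (mul_le_mul_of_nonneg_left e1 (hεpos n).le) e2
      _ = _ := by ring
  have hB0 : ∀ n ω, 0 ≤ B n ω := fun n ω => (Real.sqrt_nonneg _).trans (hle n ω)
  have hfin : ∑' n, ∫⁻ ω, ENNReal.ofReal (B n ω) ∂P ≠ ∞ := by
    have hs : Summable fun n => ε n * (2 * (1 + C) + 4) :=
      (summable_geometric_of_lt_one (by norm_num) (by norm_num)).mul_right _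
    refine ne_top_of_le_ne_top hs.tsum_ofReal_ne_top (ENNReal.tsum_le_tsum fun n => ?_)
    rw [← ofReal_integral_eq_lintegral_ofReal (hBint n) (Eventually.of_forall (hB0 n))]
    exact ENNReal.ofReal_le_ofReal (hBval n)
  rw [← lintegral_tsum fun n => (hBint n).1.aemeasurable.ennreal_ofReal] at hfin
  filter_upwards [ae_lt_top' (AEMeasurable.tsum
    fun n => (hBint n).1.aemeasurable.ennreal_ofReal) hfin] with ω hω
  apply exists_tendsto_of_summable_sqrt
  refine Summable.of_nonneg_of_le (fun n => Real.sqrt_nonneg _) (fun n => hle n ω) ?_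
  have := ENNReal.summable_toReal hω.ne
  simpa only [ENNReal.toReal_ofReal (hB0 _ ω)] using this

/-! ### Couplings and their densities -/

section Couplings

variable {X Y : Type*} [MeasurableSpace X] [MeasurableSpace Y]
  {μ μ₀ : Measure X} {ν ν₀ : Measure Y}

lemma map_fst_of_mem_couplings {π : Measure (X × Y)} (hπ : π ∈ couplings μ ν) :
    π.map Prod.fst = μ := by
  ext A hA
  rw [Measure.map_apply measurable_fst hA, ← hπ.1 A hA, Set.prod_univ]

lemma map_snd_of_mem_couplings {π : Measure (X × Y)} (hπ : π ∈ couplings μ ν) :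
    π.map Prod.snd = ν := by
  ext B hB
  rw [Measure.map_apply measurable_snd hB, ← hπ.2 B hB, Set.univ_prod]

lemma isProbabilityMeasure_of_mem_couplings [IsProbabilityMeasure μ] {π : Measure (X × Y)}
    (hπ : π ∈ couplings μ ν) : IsProbabilityMeasure π :=
  ⟨by simpa using hπ.1 Set.univ MeasurableSet.univ⟩

lemma integrable_comp_fst_iff {π : Measure (X × Y)} (hπ : π ∈ couplings μ ν) {f : X → ℝ}
    (hf : AEStronglyMeasurable f μ) : Integrable (fun p => f p.1) π ↔ Integrable f μ := by
  have h := map_fst_of_mem_couplings hπ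
  subst h
  exact (integrable_map_measure hf measurable_fst.aemeasurable).symm

lemma integrable_comp_snd_iff {π : Measure (X × Y)} (hπ : π ∈ couplings μ ν) {g : Y → ℝ}
    (hg : AEStronglyMeasurable g ν) : Integrable (fun p => g p.2) π ↔ Integrable g ν := by
  have h := map_snd_of_mem_couplings hπ
  subst h
  exact (integrable_map_measure hg measurable_snd.aemeasurable).symm

lemma integral_comp_fst {π : Measure (X × Y)} (hπ : π ∈ couplings μ ν) {f : X → ℝ}
    (hf : AEStronglyMeasurable f μ) : ∫ p, f p.1 ∂π = ∫ x, f x ∂μ := by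
  have h := map_fst_of_mem_couplings hπ
  subst h
  exact (integral_map measurable_fst.aemeasurable hf).symm

lemma integral_comp_snd {π : Measure (X × Y)} (hπ : π ∈ couplings μ ν) {g : Y → ℝ}
    (hg : AEStronglyMeasurable g ν) : ∫ p, g p.2 ∂π = ∫ y, g y ∂ν := by
  have h := map_snd_of_mem_couplings hπ
  subst h
  exact (integral_map measurable_snd.aemeasurable hg).symm

lemma integrable_densityMeasure_iff {Z : X × Y → ℝ} (hZ : AEMeasurable Z (μ₀.prod ν₀))
    (h0 : ∀ᵐ p ∂μ₀.prod ν₀, 0 ≤ Z p) {h : X × Y → ℝ} :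
    Integrable h (densityMeasure μ₀ ν₀ Z) ↔ Integrable (fun p => h p * Z p) (μ₀.prod ν₀) := by
  rw [densityMeasure, integrable_withDensity_iff_integrable_smul₀' hZ.ennreal_ofReal
    (Eventually.of_forall fun _ => ENNReal.ofReal_lt_top)]
  apply integrable_congr
  filter_upwards [h0] with p hp
  rw [ENNReal.toReal_ofReal hp, smul_eq_mul, mul_comm]

lemma integral_densityMeasure {Z : X × Y → ℝ} (hZ : AEMeasurable Z (μ₀.prod ν₀))
    (h0 : ∀ᵐ p ∂μ₀.prod ν₀, 0 ≤ Z p) (h : X × Y → ℝ) :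
    ∫ p, h p ∂(densityMeasure μ₀ ν₀ Z) = ∫ p, h p * Z p ∂(μ₀.prod ν₀) := by
  rw [densityMeasure, integral_withDensity_eq_integral_toReal_smul₀ hZ.ennreal_ofReal
    (Eventually.of_forall fun _ => ENNReal.ofReal_lt_top)]
  apply integral_congr_ae
  filter_upwards [h0] with p hp
  rw [ENNReal.toReal_ofReal hp, smul_eq_mul, mul_comm]

lemma densityMeasure_congr {Z Z' : X × Y → ℝ} (h : Z =ᵐ[μ₀.prod ν₀] Z') :
    densityMeasure μ₀ ν₀ Z = densityMeasure μ₀ ν₀ Z' :=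
  withDensity_congr_ae (by filter_upwards [h] with p hp; rw [hp])

/-- Every coupling integrates `f ⊕ g` to `∫ f dμ + ∫ g dν`. -/
lemma integral_add_mul_density {Z : X × Y → ℝ} (hZ : AEMeasurable Z (μ₀.prod ν₀))
    (h0 : ∀ᵐ p ∂μ₀.prod ν₀, 0 ≤ Z p) (hπ : densityMeasure μ₀ ν₀ Z ∈ couplings μ ν)
    {f : X → ℝ} {g : Y → ℝ} (hf : Integrable f μ) (hg : Integrable g ν) :
    Integrable (fun p => (f p.1 + g p.2) * Z p) (μ₀.prod ν₀) ∧
      ∫ p, (f p.1 + g p.2) * Z p ∂(μ₀.prod ν₀) = (∫ x, f x ∂μ) + ∫ y, g y ∂ν := by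
  have h1 := (integrable_comp_fst_iff hπ hf.1).2 hf
  have h2 := (integrable_comp_snd_iff hπ hg.1).2 hg
  refine ⟨(integrable_densityMeasure_iff hZ h0).1 (h1.add h2), ?_⟩
  rw [← integral_densityMeasure hZ h0 (fun p => f p.1 + g p.2), integral_add h1 h2,
    integral_comp_fst hπ hf.1, integral_comp_snd hπ hg.1]

end Couplings

/-! ### The product coupling -/

section ProductDensity

variable {X Y : Type*} [MeasurableSpace X] [MeasurableSpace Y]
  {μ μ₀ : Measure X} {ν ν₀ : Measure Y}

/-- A density with bounded inverse is bounded away from zero. -/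
lemma IsReference.exists_le_density [IsProbabilityMeasure μ] [IsProbabilityMeasure μ₀]
    (hμ : IsReference μ μ₀) : ∃ δ > 0, ∀ᵐ x ∂μ₀, δ ≤ (μ.rnDeriv μ₀ x).toReal := by
  obtain ⟨C, hC⟩ : ∃ C : ℝ, ∀ᵐ x ∂μ₀, ((μ.rnDeriv μ₀ x).toReal)⁻¹ ≤ C := by
    have h := hμ.inv_density_memLp.2
    rw [eLpNorm_exponent_top] at h
    refine ⟨(eLpNormEssSup (fun x => ((μ.rnDeriv μ₀ x).toReal)⁻¹) μ₀).toReal, ?_⟩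
    filter_upwards [ae_le_eLpNormEssSup (f := fun x => ((μ.rnDeriv μ₀ x).toReal)⁻¹) (μ := μ₀)]
      with x hx
    have := ENNReal.toReal_mono h.ne hx
    rw [toReal_enorm] at this
    exact (le_abs_self _).trans this
  refine ⟨(max C 1)⁻¹, by positivity, ?_⟩
  -- positivity of the density excludes the value `0⁻¹ = 0`
  filter_upwards [hC, Measure.rnDeriv_pos' hμ.ca, Measure.rnDeriv_lt_top μ μ₀] with x hx h0 h1
  have : 0 < (μ.rnDeriv μ₀ x).toReal := ENNReal.toReal_pos h0.ne' h1.ne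
  rw [inv_le_comm₀ (by positivity) this]
  exact hx.trans (le_max_left _ _)

variable (μ μ₀ ν ν₀) in
/-- The density of the product coupling `μ ⊗ ν` with respect to `μ₀ ⊗ ν₀`, real-valued:
the Radon–Nikodym derivatives are finite almost everywhere. -/
noncomputable def productDensity (p : X × Y) : ℝ :=
  (μ.rnDeriv μ₀ p.1).toReal * (ν.rnDeriv ν₀ p.2).toReal

lemma measurable_productDensity : Measurable (productDensity μ μ₀ ν ν₀) := by
  unfold productDensity
  exact ((Measure.measurable_rnDeriv μ μ₀).ennreal_toReal.comp measurable_fst).mul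
    ((Measure.measurable_rnDeriv ν ν₀).ennreal_toReal.comp measurable_snd)

lemma productDensity_nonneg (p : X × Y) : 0 ≤ productDensity μ μ₀ ν ν₀ p := by
  unfold productDensity; positivity

lemma memLp_productDensity (hμ : IsReference μ μ₀) (hν : IsReference ν ν₀) :
    MemLp (productDensity μ μ₀ ν ν₀) 2 (μ₀.prod ν₀) := by
  rw [memLp_two_iff_integrable_sq measurable_productDensity.aestronglyMeasurable]
  simp only [productDensity, mul_pow]
  exact hμ.density_memLp.integrable_sq.mul_prod hν.density_memLp.integrable_sq

variable [IsProbabilityMeasure μ] [IsProbabilityMeasure μ₀]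
  [IsProbabilityMeasure ν] [IsProbabilityMeasure ν₀]

lemma exists_le_productDensity (hμ : IsReference μ μ₀) (hν : IsReference ν ν₀) :
    ∃ δ > 0, ∀ᵐ p ∂μ₀.prod ν₀, δ ≤ productDensity μ μ₀ ν ν₀ p := by
  obtain ⟨δ, hδ, h1⟩ := hμ.exists_le_density
  obtain ⟨δ', hδ', h2⟩ := hν.exists_le_density
  refine ⟨δ * δ', by positivity, ?_⟩
  filter_upwards [Measure.quasiMeasurePreserving_fst.ae h1,
    Measure.quasiMeasurePreserving_snd.ae h2] with p hp hp'
  unfold productDensity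
  gcongr

lemma densityMeasure_productDensity (hμ : IsReference μ μ₀) (hν : IsReference ν ν₀) :
    densityMeasure μ₀ ν₀ (productDensity μ μ₀ ν ν₀) = μ.prod ν := by
  conv_rhs => rw [← Measure.withDensity_rnDeriv_eq μ μ₀ hμ.ac,
    ← Measure.withDensity_rnDeriv_eq ν ν₀ hν.ac,
    prod_withDensity (Measure.measurable_rnDeriv _ _) (Measure.measurable_rnDeriv _ _)]
  apply withDensity_congr_ae
  filter_upwards [Measure.quasiMeasurePreserving_fst.ae (Measure.rnDeriv_lt_top μ μ₀),
    Measure.quasiMeasurePreserving_snd.ae (Measure.rnDeriv_lt_top ν ν₀)] with p hp hp'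
  unfold productDensity
  rw [ENNReal.ofReal_mul ENNReal.toReal_nonneg, ENNReal.ofReal_toReal hp.ne,
    ENNReal.ofReal_toReal hp'.ne]

lemma prod_mem_couplings : μ.prod ν ∈ couplings μ ν :=
  ⟨fun A _ => by simp [Measure.prod_prod], fun B _ => by simp [Measure.prod_prod]⟩

lemma densityMeasure_productDensity_mem (hμ : IsReference μ μ₀) (hν : IsReference ν ν₀) :
    densityMeasure μ₀ ν₀ (productDensity μ μ₀ ν ν₀) ∈ couplings μ ν := by
  rw [densityMeasure_productDensity hμ hν]
  exact prod_mem_couplings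

end ProductDensity

/-! ### The dual functional -/

lemma posPartSum_nonneg {X Y : Type*} (c : X × Y → ℝ) (f : X → ℝ) (g : Y → ℝ) (p : X × Y) :
    0 ≤ posPartSum c f g p := le_max_right _ _

section Dual

variable {X Y : Type*} [MeasurableSpace X] [MeasurableSpace Y]
  {μ μ₀ : Measure X} {ν ν₀ : Measure Y} {c : X × Y → ℝ} {f : X → ℝ} {g : Y → ℝ}

lemma IsReference.aestronglyMeasurable (hμ : IsReference μ μ₀) (hf : AEStronglyMeasurable f μ) :
    AEStronglyMeasurable f μ₀ := hf.mono_ac hμ.ca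

lemma aestronglyMeasurable_posPartSum [SFinite ν₀] (hc : AEStronglyMeasurable c (μ₀.prod ν₀))
    (hf : AEStronglyMeasurable f μ₀) (hg : AEStronglyMeasurable g ν₀) :
    AEStronglyMeasurable (posPartSum c f g) (μ₀.prod ν₀) :=
  ((hf.comp_fst.add hg.comp_snd).sub hc).sup aestronglyMeasurable_const

lemma lintegral_sq_posPartSum (h : MemLp (posPartSum c f g) 2 (μ₀.prod ν₀)) :
    ∫⁻ p, ENNReal.ofReal (posPartSum c f g p ^ 2) ∂(μ₀.prod ν₀) =
      ENNReal.ofReal (∫ p, posPartSum c f g p ^ 2 ∂(μ₀.prod ν₀)) :=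
  (ofReal_integral_eq_lintegral_ofReal h.integrable_sq
    (Eventually.of_forall fun _ => sq_nonneg _)).symm

lemma coe_half_mul_ofReal {t : ℝ} (ht : 0 ≤ t) :
    ((1 / 2 * ENNReal.ofReal t : ℝ≥0∞) : EReal) = ((1 / 2 * t : ℝ) : EReal) := by
  rw [← ENNReal.ofReal_ofNat 2, ← ENNReal.ofReal_one, ← ENNReal.ofReal_div_of_pos two_pos,
    ← ENNReal.ofReal_mul (by norm_num), EReal.coe_ennreal_ofReal, max_eq_left (by positivity)]

lemma dualObj_eq_coe (h : MemLp (posPartSum c f g) 2 (μ₀.prod ν₀)) :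
    dualObj μ μ₀ ν ν₀ c f g = (((∫ x, f x ∂μ) + (∫ y, g y ∂ν)
      - 1 / 2 * ∫ p, posPartSum c f g p ^ 2 ∂(μ₀.prod ν₀) : ℝ) : EReal) := by
  rw [dualObj, lintegral_sq_posPartSum h,
    coe_half_mul_ofReal (integral_nonneg fun _ => sq_nonneg _), ← EReal.coe_sub]

/-- The dual functional is `-∞` where `(f ⊕ g - c)₊` fails to be square-integrable. -/
lemma memLp_posPartSum_of_dualObj_ne_bot
    (hm : AEStronglyMeasurable (posPartSum c f g) (μ₀.prod ν₀))
    (h : dualObj μ μ₀ ν ν₀ c f g ≠ ⊥) : MemLp (posPartSum c f g) 2 (μ₀.prod ν₀) := by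
  rw [memLp_two_iff_integrable_sq hm]
  refine ⟨hm.pow 2, ?_⟩
  rw [hasFiniteIntegral_iff_ofReal (Eventually.of_forall fun _ => sq_nonneg _)]
  by_contra h'
  rw [not_lt, top_le_iff] at h'
  apply h
  rw [dualObj, h', ENNReal.mul_top (by simp)]
  rfl

end Dual

/-! ### Attainment of the dual supremum -/

/-- The integrand of the dual problem written in terms of `u = f ⊕ g - c` and a coupling density
`z`: since `∫ (f ⊕ g) z dP = ∫ f dμ + ∫ g dν`, its integral is the dual functional up to the
constant `∫ c z dP`. -/
noncomputable def dualIntegrand (z u : ℝ) : ℝ := u * z - 1 / 2 * max u 0 ^ 2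

lemma continuous_dualIntegrand : Continuous fun q : ℝ × ℝ => dualIntegrand q.1 q.2 := by
  unfold dualIntegrand; fun_prop

lemma dualIntegrand_le {z : ℝ} (hz : 0 ≤ z) (u : ℝ) : dualIntegrand z u ≤ 1 / 2 * z ^ 2 := by
  unfold dualIntegrand
  have : u * z ≤ max u 0 * z := by gcongr; exact le_max_left _ _
  nlinarith [sq_nonneg (max u 0 - z)]

/-- Coercivity of the dual integrand: this bounds near-maximizers in `L¹`. -/
lemma abs_mul_le_sub_dualIntegrand (z u : ℝ) :
    |u| * z ≤ 2 * z ^ 2 - dualIntegrand z u := by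
  unfold dualIntegrand
  have : |u| = 2 * max u 0 - u := by
    rcases le_total u 0 with h | h
    · rw [abs_of_nonpos h, max_eq_right h]; ring
    · rw [abs_of_nonneg h, max_eq_left h]; ring
  rw [this]
  nlinarith [sq_nonneg (max u 0 - 2 * z)]

lemma midpoint_dualIntegrand_le (z u v : ℝ) :
    (dualIntegrand z u + dualIntegrand z v) / 2 ≤ dualIntegrand z ((u + v) / 2) := by
  unfold dualIntegrand
  have h0 : max ((u + v) / 2) 0 ≤ (max u 0 + max v 0) / 2 := by
    apply max_le
    · linarith [le_max_left u 0, le_max_left v 0]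
    · linarith [le_max_right u 0, le_max_right v 0]
  have h1 : max ((u + v) / 2) 0 ^ 2 ≤ ((max u 0 + max v 0) / 2) ^ 2 := by
    gcongr
  nlinarith [sq_nonneg (max u 0 - max v 0)]

lemma posPartSum_midpoint_le {X Y : Type*} (c : X × Y → ℝ) (f f' : X → ℝ) (g g' : Y → ℝ)
    (p : X × Y) : posPartSum c (fun x => (f x + f' x) / 2) (fun y => (g y + g' y) / 2) p ≤
      (posPartSum c f g p + posPartSum c f' g' p) / 2 := by
  unfold posPartSum
  apply max_le
  · linarith [le_max_left (f p.1 + g p.2 - c p) 0, le_max_left (f' p.1 + g' p.2 - c p) 0]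
  · linarith [le_max_right (f p.1 + g p.2 - c p) 0, le_max_right (f' p.1 + g' p.2 - c p) 0]

section

variable {X Y : Type*} [MeasurableSpace X] [MeasurableSpace Y]

lemma posPartSum_zero_memLp {μ₀ : Measure X} {ν₀ : Measure Y} {c : X × Y → ℝ}
    (hc : MemLp c 2 (μ₀.prod ν₀)) :
    MemLp (posPartSum c (fun _ => 0) fun _ => 0) 2 (μ₀.prod ν₀) := by
  refine hc.mono ((aestronglyMeasurable_const.sub hc.1).sup aestronglyMeasurable_const) ?_
  refine Eventually.of_forall fun p => ?_
  rw [Real.norm_of_nonneg (posPartSum_nonneg _ _ _ _), Real.norm_eq_abs]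
  exact max_le (by simpa using neg_le_abs (c p)) (abs_nonneg _)

lemma memLp_posPartSum_midpoint {μ₀ : Measure X} {ν₀ : Measure Y} [SFinite ν₀]
    {c : X × Y → ℝ} (hc : AEStronglyMeasurable c (μ₀.prod ν₀))
    {f f' : X → ℝ} {g g' : Y → ℝ}
    (hf : AEStronglyMeasurable f μ₀) (hf' : AEStronglyMeasurable f' μ₀)
    (hg : AEStronglyMeasurable g ν₀) (hg' : AEStronglyMeasurable g' ν₀)
    (h : MemLp (posPartSum c f g) 2 (μ₀.prod ν₀))
    (h' : MemLp (posPartSum c f' g') 2 (μ₀.prod ν₀)) :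
    MemLp (posPartSum c (fun x => (f x + f' x) / 2) fun y => (g y + g' y) / 2) 2
      (μ₀.prod ν₀) := by
  refine (h.add h').mono (aestronglyMeasurable_posPartSum hc ?_ ?_) ?_
  · exact ((hf.add hf').mul_const (2⁻¹ : ℝ)).congr (Eventually.of_forall fun x => by
      simp [div_eq_mul_inv])
  · exact ((hg.add hg').mul_const (2⁻¹ : ℝ)).congr (Eventually.of_forall fun y => by
      simp [div_eq_mul_inv])
  refine Eventually.of_forall fun p => ?_
  have := posPartSum_midpoint_le c f f' g g' p
  have h1 := posPartSum_nonneg c f g p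
  have h2 := posPartSum_nonneg c f' g' p
  rw [Real.norm_of_nonneg (posPartSum_nonneg _ _ _ _), Pi.add_apply,
    Real.norm_of_nonneg (add_nonneg h1 h2)]
  linarith

/-- An almost everywhere limit of functions of the form `f ⊕ g` is again of this form: after
subtracting the constants `f n x₀` for a suitable `x₀`, both summands converge. -/
lemma exists_tendsto_add {μ₀ : Measure X} {ν₀ : Measure Y}
    [IsProbabilityMeasure μ₀] [IsProbabilityMeasure ν₀] {f : ℕ → X → ℝ} {g : ℕ → Y → ℝ}
    (hf : ∀ n, AEMeasurable (f n) μ₀) (hg : ∀ n, AEMeasurable (g n) ν₀)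
    (h : ∀ᵐ p ∂μ₀.prod ν₀, ∃ l, Tendsto (fun n => f n p.1 + g n p.2) atTop (𝓝 l)) :
    ∃ (f' : X → ℝ) (g' : Y → ℝ), Measurable f' ∧ Measurable g' ∧
      ∀ᵐ p ∂μ₀.prod ν₀, Tendsto (fun n => f n p.1 + g n p.2) atTop (𝓝 (f' p.1 + g' p.2)) := by
  have h1 := Measure.ae_ae_of_ae_prod h
  obtain ⟨x₀, hx₀⟩ := h1.exists
  have hg' : ∀ᵐ y ∂ν₀, ∃ l, Tendsto (fun n => g n y + f n x₀) atTop (𝓝 l) := by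
    filter_upwards [hx₀] with y hy
    simpa only [add_comm] using hy
  have hf' : ∀ᵐ x ∂μ₀, ∃ l, Tendsto (fun n => f n x - f n x₀) atTop (𝓝 l) := by
    filter_upwards [h1] with x hx
    obtain ⟨y, ⟨l, hl⟩, ⟨l', hl'⟩⟩ := (hx.and hx₀).exists
    refine ⟨l - l', (hl.sub hl').congr fun n => by ring⟩
  obtain ⟨f', hf'm, hf'⟩ := measurable_limit_of_tendsto_metrizable_ae
    (fun n => (hf n).sub_const _) hf'
  obtain ⟨g', hg'm, hg'⟩ := measurable_limit_of_tendsto_metrizable_ae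
    (fun n => (hg n).add_const _) hg'
  refine ⟨f', g', hf'm, hg'm, ?_⟩
  filter_upwards [Measure.quasiMeasurePreserving_fst.ae hf',
    Measure.quasiMeasurePreserving_snd.ae hg'] with p hp hp'
  exact (hp.add hp').congr fun n => by ring

variable {μ μ₀ : Measure X} {ν ν₀ : Measure Y} {c : X × Y → ℝ}
  [IsProbabilityMeasure μ] [IsProbabilityMeasure μ₀]
  [IsProbabilityMeasure ν] [IsProbabilityMeasure ν₀]

lemma integral_dualIntegrand (hμ : IsReference μ μ₀) (hν : IsReference ν ν₀)
    (hc : MemLp c 2 (μ₀.prod ν₀)) {f : X → ℝ} {g : Y → ℝ} (hf : Integrable f μ)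
    (hg : Integrable g ν) (h : MemLp (posPartSum c f g) 2 (μ₀.prod ν₀)) :
    Integrable (fun p => dualIntegrand (productDensity μ μ₀ ν ν₀ p) (f p.1 + g p.2 - c p))
        (μ₀.prod ν₀) ∧
      ∫ p, dualIntegrand (productDensity μ μ₀ ν ν₀ p) (f p.1 + g p.2 - c p) ∂(μ₀.prod ν₀) =
        (∫ x, f x ∂μ) + (∫ y, g y ∂ν) - 1 / 2 * (∫ p, posPartSum c f g p ^ 2 ∂(μ₀.prod ν₀))
          - ∫ p, c p * productDensity μ μ₀ ν ν₀ p ∂(μ₀.prod ν₀) := by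
  obtain ⟨h1, h1'⟩ := integral_add_mul_density
    (measurable_productDensity (μ := μ) (μ₀ := μ₀) (ν := ν) (ν₀ := ν₀)).aemeasurable
    (Eventually.of_forall productDensity_nonneg)
    (densityMeasure_productDensity_mem hμ hν) hf hg
  have h2 : Integrable (fun p => c p * productDensity μ μ₀ ν ν₀ p) (μ₀.prod ν₀) :=
    hc.integrable_mul (memLp_productDensity hμ hν)
  have h3 := h.integrable_sq.const_mul (1 / 2)
  have e : (fun p => dualIntegrand (productDensity μ μ₀ ν ν₀ p) (f p.1 + g p.2 - c p)) =
      fun p => (f p.1 + g p.2) * productDensity μ μ₀ ν ν₀ p - 1 / 2 * posPartSum c f g p ^ 2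
        - c p * productDensity μ μ₀ ν ν₀ p := by
    ext p
    simp only [dualIntegrand, posPartSum]
    ring
  rw [e]
  have h13 : Integrable (fun p => (f p.1 + g p.2) * productDensity μ μ₀ ν ν₀ p
      - 1 / 2 * posPartSum c f g p ^ 2) (μ₀.prod ν₀) := h1.sub h3
  refine ⟨h13.sub h2, ?_⟩
  rw [integral_sub h13 h2, integral_sub h1 h3, h1', integral_const_mul]

/-- The dual integrand is upper semicontinuous along almost everywhere convergence, as it is
bounded above by an integrable function (reverse Fatou). -/
lemma dualIntegrand_limit {Ω : Type*} [MeasurableSpace Ω] {P : Measure Ω} {z : Ω → ℝ}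
    (hz : MemLp z 2 P) (hz0 : ∀ ω, 0 ≤ z ω) {u : ℕ → Ω → ℝ} {v : Ω → ℝ}
    (hum : ∀ n, Integrable (fun ω => dualIntegrand (z ω) (u n ω)) P)
    (hvm : AEStronglyMeasurable v P)
    (hlim : ∀ᵐ ω ∂P, Tendsto (fun n => u n ω) atTop (𝓝 (v ω))) {a : ℕ → ℝ} {d : ℝ}
    (ha : Tendsto a atTop (𝓝 d)) (hle : ∀ n, a n ≤ ∫ ω, dualIntegrand (z ω) (u n ω) ∂P) :
    Integrable (fun ω => dualIntegrand (z ω) (v ω)) P ∧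
      d ≤ ∫ ω, dualIntegrand (z ω) (v ω) ∂P := by
  have hz2 : Integrable (fun ω => 1 / 2 * z ω ^ 2) P := hz.integrable_sq.const_mul _
  set I := ∫ ω, 1 / 2 * z ω ^ 2 ∂P
  have hFn : ∀ n, ∫⁻ ω, ENNReal.ofReal (1 / 2 * z ω ^ 2 - dualIntegrand (z ω) (u n ω)) ∂P ≤
      ENNReal.ofReal (I - a n) := by
    intro n
    have hi : Integrable (fun ω => 1 / 2 * z ω ^ 2 - dualIntegrand (z ω) (u n ω)) P :=
      hz2.sub (hum n)
    rw [← ofReal_integral_eq_lintegral_ofReal hi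
      (Eventually.of_forall fun ω => sub_nonneg.2 (dualIntegrand_le (hz0 ω) _)),
      integral_sub hz2 (hum n)]
    exact ENNReal.ofReal_le_ofReal (by linarith [hle n])
  have hmv : AEStronglyMeasurable (fun ω => dualIntegrand (z ω) (v ω)) P :=
    continuous_dualIntegrand.comp_aestronglyMeasurable (hz.1.prodMk hvm)
  have hF : ∫⁻ ω, ENNReal.ofReal (1 / 2 * z ω ^ 2 - dualIntegrand (z ω) (v ω)) ∂P ≤
      ENNReal.ofReal (I - d) := by
    calc _ = ∫⁻ ω, liminf (fun n =>
          ENNReal.ofReal (1 / 2 * z ω ^ 2 - dualIntegrand (z ω) (u n ω))) atTop ∂P := by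
          apply lintegral_congr_ae
          filter_upwards [hlim] with ω hω
          refine (Tendsto.liminf_eq ?_).symm
          refine ENNReal.tendsto_ofReal (tendsto_const_nhds.sub ?_)
          exact (continuous_dualIntegrand.tendsto (z ω, v ω)).comp
            (tendsto_const_nhds.prodMk_nhds hω)
      _ ≤ liminf (fun n => ∫⁻ ω,
          ENNReal.ofReal (1 / 2 * z ω ^ 2 - dualIntegrand (z ω) (u n ω)) ∂P) atTop :=
          lintegral_liminf_le' fun n => (hz2.sub (hum n)).1.aemeasurable.ennreal_ofReal
      _ ≤ liminf (fun n => ENNReal.ofReal (I - a n)) atTop :=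
          liminf_le_liminf (Eventually.of_forall hFn)
      _ = ENNReal.ofReal (I - d) :=
          (ENNReal.tendsto_ofReal (tendsto_const_nhds.sub ha)).liminf_eq
  have hnn : ∀ ω, 0 ≤ 1 / 2 * z ω ^ 2 - dualIntegrand (z ω) (v ω) :=
    fun ω => sub_nonneg.2 (dualIntegrand_le (hz0 ω) _)
  have hint : Integrable (fun ω => 1 / 2 * z ω ^ 2 - dualIntegrand (z ω) (v ω)) P := by
    refine ⟨hz2.1.sub hmv, ?_⟩
    rw [hasFiniteIntegral_iff_ofReal (Eventually.of_forall hnn)]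
    exact hF.trans_lt ENNReal.ofReal_lt_top
  have hint' : Integrable (fun ω => dualIntegrand (z ω) (v ω)) P :=
    (hz2.sub hint).congr (Eventually.of_forall fun ω => by simp)
  refine ⟨hint', ?_⟩
  have hId : d ≤ I := by
    refine le_of_tendsto ha (Eventually.of_forall fun n => (hle n).trans ?_)
    exact integral_mono (hum n) hz2 fun ω => dualIntegrand_le (hz0 ω) _
  rw [← ofReal_integral_eq_lintegral_ofReal hint (Eventually.of_forall hnn),
    integral_sub hz2 hint', ENNReal.ofReal_le_ofReal_iff (by linarith)] at hF
  linarith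

/-- The dual problem has a measurable solution: near-maximizers are bounded in `L¹`, so the
convergence theorem for nested convex sets applies to the functions `f ⊕ g - c`. -/
theorem exists_isDualSolution (hμ : IsReference μ μ₀) (hν : IsReference ν ν₀)
    (hc : MemLp c 2 (μ₀.prod ν₀)) :
    ∃ (f : X → ℝ) (g : Y → ℝ), Measurable f ∧ Measurable g ∧
      IsDualSolution μ μ₀ ν ν₀ c f g := by
  set P := μ₀.prod ν₀ with hP
  set z := productDensity μ μ₀ ν ν₀ with hz
  have hzL : MemLp z 2 P := memLp_productDensity hμ hν
  have hz0 : ∀ p, 0 ≤ z p := productDensity_nonneg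
  obtain ⟨δ, hδ, hzδ⟩ := exists_le_productDensity hμ hν
  have hz2 := hzL.integrable_sq
  -- the finite values of the dual functional, up to the constant `∫ c z dP`
  set A : Set ℝ := {t | ∃ (f : X → ℝ) (g : Y → ℝ), Integrable f μ ∧ Integrable g ν ∧
    MemLp (posPartSum c f g) 2 P ∧ t = ∫ p, dualIntegrand (z p) (f p.1 + g p.2 - c p) ∂P} with hA
  have hAne : A.Nonempty := ⟨_, fun _ => 0, fun _ => 0, integrable_zero _ _ _,
    integrable_zero _ _ _, posPartSum_zero_memLp hc, rfl⟩
  have hAbdd : BddAbove A := by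
    refine ⟨∫ p, 1 / 2 * z p ^ 2 ∂P, ?_⟩
    rintro _ ⟨f, g, hf, hg, hfg, rfl⟩
    exact integral_mono (integral_dualIntegrand hμ hν hc hf hg hfg).1 (hz2.const_mul _)
      fun p => dualIntegrand_le (hz0 p) _
  set d := sSup A with hd
  set a : ℕ → ℝ := fun n => d - 1 / ((n : ℝ) + 1) with ha
  have halt : ∀ n, a n < d := fun n => sub_lt_self _ Nat.one_div_pos_of_nat
  have hamono : Monotone a := fun m n hmn => sub_le_sub_left (Nat.one_div_le_one_div hmn) _
  have halim : Tendsto a atTop (𝓝 d) := by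
    have := (tendsto_const_nhds (x := d)).sub (tendsto_one_div_add_atTop_nhds_zero_nat (𝕜 := ℝ))
    rwa [sub_zero] at this
  -- the superlevel sets `K n` consist of near-maximizers `f ⊕ g - c`
  set K : ℕ → Set (X × Y → ℝ) := fun n => {u | ∃ (f : X → ℝ) (g : Y → ℝ), Integrable f μ ∧
    Integrable g ν ∧ MemLp (posPartSum c f g) 2 P ∧ u = (fun p => f p.1 + g p.2 - c p) ∧
    a n ≤ ∫ p, dualIntegrand (z p) (u p) ∂P} with hK
  have hKanti : Antitone K := by
    rintro m n hmn u ⟨f, g, hf, hg, hfg, hu, hle⟩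
    exact ⟨f, g, hf, hg, hfg, hu, (hamono hmn).trans hle⟩
  have hKne : ∀ n, (K n).Nonempty := by
    intro n
    obtain ⟨_, ⟨f, g, hf, hg, hfg, rfl⟩, hlt⟩ := exists_lt_of_lt_csSup hAne (halt n)
    exact ⟨_, f, g, hf, hg, hfg, rfl, hlt.le⟩
  have hKmid : ∀ n, ∀ u ∈ K n, ∀ v ∈ K n, (fun p => (u p + v p) / 2) ∈ K n := by
    rintro n _ ⟨f, g, hf, hg, hfg, rfl, hle⟩ _ ⟨f', g', hf', hg', hfg', rfl, hle'⟩
    have hF : Integrable (fun x => (f x + f' x) / 2) μ := (hf.add hf').div_const 2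
    have hG : Integrable (fun y => (g y + g' y) / 2) ν := (hg.add hg').div_const 2
    have hFG := memLp_posPartSum_midpoint hc.1 (hμ.aestronglyMeasurable hf.1)
      (hμ.aestronglyMeasurable hf'.1) (hν.aestronglyMeasurable hg.1)
      (hν.aestronglyMeasurable hg'.1) hfg hfg'
    have e : (fun p : X × Y => (f p.1 + g p.2 - c p + (f' p.1 + g' p.2 - c p)) / 2) =
        fun p => (f p.1 + f' p.1) / 2 + (g p.2 + g' p.2) / 2 - c p := by
      ext p; ring
    refine ⟨_, _, hF, hG, hFG, e, ?_⟩
    have i1 := (integral_dualIntegrand hμ hν hc hf hg hfg).1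
    have i2 := (integral_dualIntegrand hμ hν hc hf' hg' hfg').1
    have i3 := (integral_dualIntegrand hμ hν hc hF hG hFG).1
    calc a n ≤ ((∫ p, dualIntegrand (z p) (f p.1 + g p.2 - c p) ∂P)
          + ∫ p, dualIntegrand (z p) (f' p.1 + g' p.2 - c p) ∂P) / 2 := by linarith
      _ = ∫ p, (dualIntegrand (z p) (f p.1 + g p.2 - c p)
          + dualIntegrand (z p) (f' p.1 + g' p.2 - c p)) / 2 ∂P := by
          rw [integral_div, integral_add i1 i2]
      _ ≤ _ := by
          refine integral_mono ((i1.add i2).div_const 2) ?_ fun p => midpoint_dualIntegrand_le _ _ _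
          simp only [congrFun e]
          exact i3
  -- near-maximizers are bounded in `L¹(P)` since `z` is bounded away from zero
  have hbound : ∀ u : X × Y → ℝ, AEStronglyMeasurable u P →
      Integrable (fun p => dualIntegrand (z p) (u p)) P →
      Integrable u P ∧ ∫ p, |u p| ∂P ≤
        (2 * (∫ p, z p ^ 2 ∂P) - ∫ p, dualIntegrand (z p) (u p) ∂P) / δ := by
    intro u hum hui
    have hle : ∀ᵐ p ∂P, |u p| ≤ (2 * z p ^ 2 - dualIntegrand (z p) (u p)) / δ := by
      filter_upwards [hzδ] with p hp
      rw [le_div_iff₀ hδ]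
      exact (mul_le_mul_of_nonneg_left hp (abs_nonneg _)).trans (abs_mul_le_sub_dualIntegrand _ _)
    have hB := ((hz2.const_mul 2).sub hui).div_const δ
    have hu : Integrable u P := hB.mono' hum hle
    refine ⟨hu, (integral_mono_ae hu.abs hB hle).trans_eq ?_⟩
    simp only [Pi.sub_apply]
    rw [integral_div, integral_sub (hz2.const_mul 2) hui, integral_const_mul]
  have hKint : ∀ n, ∀ u ∈ K n, Integrable u P ∧
      ∫ p, |u p| ∂P ≤ (2 * (∫ p, z p ^ 2 ∂P) - a 0) / δ := by
    rintro n _ ⟨f, g, hf, hg, hfg, rfl, hle⟩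
    obtain ⟨h1, h2⟩ := hbound _ (((hμ.aestronglyMeasurable hf.1).comp_fst.add
      (hν.aestronglyMeasurable hg.1).comp_snd).sub hc.1)
      (integral_dualIntegrand hμ hν hc hf hg hfg).1
    refine ⟨h1, h2.trans ?_⟩
    gcongr
    exact (hamono n.zero_le).trans hle
  obtain ⟨u, huK, hulim⟩ := exists_seq_tendsto_ae_of_antitone hKanti hKne hKmid hKint
  choose fn gn hfn hgn hfgn hu hle using huK
  obtain ⟨f, g, hfm, hgm, hlim⟩ := exists_tendsto_add
    (fun n => (hμ.aestronglyMeasurable (hfn n).1).aemeasurable)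
    (fun n => (hν.aestronglyMeasurable (hgn n).1).aemeasurable) (by
      filter_upwards [hulim] with p ⟨l, hl⟩
      refine ⟨l + c p, (hl.add_const (c p)).congr fun n => ?_⟩
      rw [hu n]; ring)
  set v : X × Y → ℝ := fun p => f p.1 + g p.2 - c p with hv
  have hvm : AEStronglyMeasurable v P :=
    (hfm.aestronglyMeasurable.comp_fst.add hgm.aestronglyMeasurable.comp_snd).sub hc.1
  obtain ⟨hvint, hvd⟩ := dualIntegrand_limit hzL hz0 (u := u) (v := v)
    (fun n => by
      rw [hu n]; exact (integral_dualIntegrand hμ hν hc (hfn n) (hgn n) (hfgn n)).1)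
    hvm (by
      filter_upwards [hlim] with p hp
      refine (hp.sub_const (c p)).congr fun n => ?_
      rw [hu n]) halim hle
  -- integrability of the limit is read off from that of the dual integrand, by coercivity
  have hvz : Integrable (fun p => v p * z p) P := by
    refine ((hz2.const_mul 2).sub hvint).mono' (hvm.mul hzL.1) (Eventually.of_forall fun p => ?_)
    rw [norm_mul, Real.norm_eq_abs, Real.norm_of_nonneg (hz0 p)]
    exact abs_mul_le_sub_dualIntegrand _ _
  have hpos : MemLp (posPartSum c f g) 2 P := by
    rw [memLp_two_iff_integrable_sq (aestronglyMeasurable_posPartSum hc.1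
      hfm.aestronglyMeasurable hgm.aestronglyMeasurable)]
    refine ((hvz.sub hvint).const_mul 2).congr (Eventually.of_forall fun p => ?_)
    simp only [Pi.sub_apply, dualIntegrand, posPartSum, hv]
    ring
  have hfgz : Integrable (fun p => (f p.1 + g p.2) * z p) P := by
    refine (hvz.add (hc.integrable_mul hzL)).congr (Eventually.of_forall fun p => ?_)
    simp only [Pi.add_apply, Pi.mul_apply, hv]
    ring
  have hfg : Integrable (fun p => f p.1 + g p.2) (μ.prod ν) := by
    rw [← densityMeasure_productDensity hμ hν]
    exact (integrable_densityMeasure_iff measurable_productDensity.aemeasurable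
      (Eventually.of_forall productDensity_nonneg)).2 hfgz
  have hfi : Integrable f μ := by
    obtain ⟨y, hy⟩ := hfg.prod_left_ae.exists
    exact (hy.sub (integrable_const (g y))).congr (Eventually.of_forall fun x => by simp)
  have hgi : Integrable g ν := by
    obtain ⟨x, hx⟩ := hfg.prod_right_ae.exists
    exact (hx.sub (integrable_const (f x))).congr (Eventually.of_forall fun y => by simp)
  refine ⟨f, g, hfm, hgm, hfi, hgi, fun f' g' hf' hg' => ?_⟩
  by_cases hbot : dualObj μ μ₀ ν ν₀ c f' g' = ⊥
  · rw [hbot]; exact bot_le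
  have hpos' := memLp_posPartSum_of_dualObj_ne_bot (aestronglyMeasurable_posPartSum hc.1
    (hμ.aestronglyMeasurable hf'.1) (hν.aestronglyMeasurable hg'.1)) hbot
  rw [dualObj_eq_coe hpos', dualObj_eq_coe hpos, EReal.coe_le_coe_iff]
  have h1 := (integral_dualIntegrand hμ hν hc hf' hg' hpos').2
  have h2 := (integral_dualIntegrand hμ hν hc hfi hgi hpos).2
  have h3 := le_csSup hAbdd ⟨f', g', hf', hg', hpos', rfl⟩
  linarith

end

/-! ### First-order condition for the dual problem -/

section Marginals

variable {X Y : Type*} [MeasurableSpace X] [MeasurableSpace Y]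
  {μ μ₀ : Measure X} {ν ν₀ : Measure Y} {c : X × Y → ℝ} {f : X → ℝ} {g : Y → ℝ}

lemma isCouplingDensity_iff :
    IsCouplingDensity μ μ₀ ν ν₀ c f g ↔
      densityMeasure μ₀ ν₀ (posPartSum c f g) ∈ couplings μ ν :=
  ⟨fun ⟨_, h, e⟩ => e ▸ h, fun h => ⟨_, h, rfl⟩⟩

lemma eq_zero_of_forall_mul_le {m q : ℝ} (hq : 0 ≤ q) (h : ∀ t : ℝ, t * m ≤ t ^ 2 * q) :
    m = 0 := by
  have h1 := h (m / (q + 1))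
  have hq1 : 0 < q + 1 := by linarith
  have e1 : m / (q + 1) * m = m ^ 2 / (q + 1) ^ 2 * (q + 1) := by field_simp
  have e2 : (m / (q + 1)) ^ 2 * q = m ^ 2 / (q + 1) ^ 2 * q := by rw [div_pow]
  have h2 : m ^ 2 / (q + 1) ^ 2 ≤ 0 := by linarith
  have h3 : m ^ 2 ≤ 0 := by
    rwa [div_le_iff₀ (by positivity), zero_mul] at h2
  exact pow_eq_zero_iff two_ne_zero |>.1 (le_antisymm h3 (sq_nonneg m))

lemma sq_max_add_le (u s : ℝ) : max (u + s) 0 ^ 2 ≤ max u 0 ^ 2 + 2 * s * max u 0 + s ^ 2 := by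
  rcases le_total (u + s) 0 with h | h
  · rw [max_eq_right h]
    nlinarith [sq_nonneg (max u 0 + s)]
  · rw [max_eq_left h]
    have := le_max_left u 0
    nlinarith

/-- A solution of the dual problem gives a square-integrable `(f ⊕ g - c)₊`, and the derivative of
the dual functional vanishes in every direction `φ ⊕ ψ ∈ L²(P)`. -/
lemma IsDualSolution.first_order [IsProbabilityMeasure ν₀] (hμ : IsReference μ μ₀)
    (hν : IsReference ν ν₀) (hc : MemLp c 2 (μ₀.prod ν₀)) (h : IsDualSolution μ μ₀ ν ν₀ c f g) :
    MemLp (posPartSum c f g) 2 (μ₀.prod ν₀) ∧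
      ∀ (φ : X → ℝ) (ψ : Y → ℝ), Integrable φ μ → Integrable ψ ν →
        MemLp (fun p => φ p.1 + ψ p.2) 2 (μ₀.prod ν₀) →
        ∫ p, (φ p.1 + ψ p.2) * posPartSum c f g p ∂(μ₀.prod ν₀) =
          (∫ x, φ x ∂μ) + ∫ y, ψ y ∂ν := by
  obtain ⟨hf, hg, hmax⟩ := h
  have hUm := aestronglyMeasurable_posPartSum hc.1 (hμ.aestronglyMeasurable hf.1)
    (hν.aestronglyMeasurable hg.1)
  have hU : MemLp (posPartSum c f g) 2 (μ₀.prod ν₀) := by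
    apply memLp_posPartSum_of_dualObj_ne_bot (μ := μ) (ν := ν) hUm
    have h0 := hmax (fun _ => 0) (fun _ => 0) (integrable_zero X ℝ μ) (integrable_zero Y ℝ ν)
    rw [dualObj_eq_coe (posPartSum_zero_memLp hc)] at h0
    exact ne_bot_of_le_ne_bot (EReal.coe_ne_bot _) h0
  refine ⟨hU, fun φ ψ hφ hψ hL => ?_⟩
  set P := μ₀.prod ν₀
  have hi1 : Integrable (fun p => posPartSum c f g p ^ 2) P := hU.integrable_sq
  have hi2 : Integrable (fun p => (φ p.1 + ψ p.2) * posPartSum c f g p) P := hL.integrable_mul hU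
  have hi3 : Integrable (fun p => (φ p.1 + ψ p.2) ^ 2) P := hL.integrable_sq
  have key : ∀ t : ℝ, t * ((∫ x, φ x ∂μ) + (∫ y, ψ y ∂ν)
      - ∫ p, (φ p.1 + ψ p.2) * posPartSum c f g p ∂P) ≤
      t ^ 2 * (1 / 2 * ∫ p, (φ p.1 + ψ p.2) ^ 2 ∂P) := by
    intro t
    have hft : Integrable (fun x => f x + t * φ x) μ := hf.add (hφ.const_mul t)
    have hgt : Integrable (fun y => g y + t * ψ y) ν := hg.add (hψ.const_mul t)
    set U' := posPartSum c (fun x => f x + t * φ x) (fun y => g y + t * ψ y) with hU'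
    have hle : ∀ p, U' p ^ 2 ≤ posPartSum c f g p ^ 2
        + 2 * t * ((φ p.1 + ψ p.2) * posPartSum c f g p) + t ^ 2 * (φ p.1 + ψ p.2) ^ 2 := by
      intro p
      have := sq_max_add_le (f p.1 + g p.2 - c p) (t * (φ p.1 + ψ p.2))
      simp only [hU', posPartSum]
      rw [show f p.1 + t * φ p.1 + (g p.2 + t * ψ p.2) - c p =
        f p.1 + g p.2 - c p + t * (φ p.1 + ψ p.2) by ring]
      linarith
    have hB1 : Integrable (fun p => posPartSum c f g p ^ 2
        + 2 * t * ((φ p.1 + ψ p.2) * posPartSum c f g p)) P := hi1.add (hi2.const_mul _)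
    have hB := hB1.add (hi3.const_mul (t ^ 2))
    have hUm' : AEStronglyMeasurable U' P := aestronglyMeasurable_posPartSum hc.1
      (hμ.aestronglyMeasurable hft.1) (hν.aestronglyMeasurable hgt.1)
    have hUi' : Integrable (fun p => U' p ^ 2) P := by
      refine hB.mono' (hUm'.pow 2) (Eventually.of_forall fun p => ?_)
      rw [Real.norm_of_nonneg (sq_nonneg _)]
      exact hle p
    have hU'L : MemLp U' 2 P := (memLp_two_iff_integrable_sq hUm').2 hUi'
    have hI : ∫ p, U' p ^ 2 ∂P ≤ (∫ p, posPartSum c f g p ^ 2 ∂P)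
        + 2 * t * (∫ p, (φ p.1 + ψ p.2) * posPartSum c f g p ∂P)
        + t ^ 2 * ∫ p, (φ p.1 + ψ p.2) ^ 2 ∂P := by
      refine (integral_mono hUi' hB hle).trans_eq ?_
      simp only [Pi.add_apply]
      rw [integral_add hB1 (hi3.const_mul _), integral_add hi1 (hi2.const_mul _),
        integral_const_mul, integral_const_mul]
    have hD := hmax _ _ hft hgt
    rw [dualObj_eq_coe hU'L, dualObj_eq_coe hU, EReal.coe_le_coe_iff,
      integral_add hf (hφ.const_mul t), integral_add hg (hψ.const_mul t), integral_const_mul,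
      integral_const_mul] at hD
    linarith
  have hq : 0 ≤ ∫ p, (φ p.1 + ψ p.2) ^ 2 ∂P := integral_nonneg fun _ => sq_nonneg _
  have := eq_zero_of_forall_mul_le (by positivity) key
  linarith

variable [IsProbabilityMeasure μ] [IsProbabilityMeasure μ₀]
  [IsProbabilityMeasure ν] [IsProbabilityMeasure ν₀]

lemma withDensity_ofReal_apply {Ω : Type*} [MeasurableSpace Ω] {P : Measure Ω} {U : Ω → ℝ}
    (hU : Integrable U P) (h0 : ∀ ω, 0 ≤ U ω) {s : Set Ω} (hs : MeasurableSet s) :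
    P.withDensity (fun ω => ENNReal.ofReal (U ω)) s =
      ENNReal.ofReal (∫ ω, s.indicator 1 ω * U ω ∂P) := by
  rw [withDensity_apply _ hs, ← ofReal_integral_eq_lintegral_ofReal hU.integrableOn
    (Eventually.of_forall h0), ← integral_indicator hs]
  congr 2
  ext ω
  by_cases h : ω ∈ s <;> simp [h]

lemma memLp_indicator_one {Ω : Type*} [MeasurableSpace Ω] {P : Measure Ω} [IsFiniteMeasure P]
    {s : Set Ω} (hs : MeasurableSet s) : MemLp (s.indicator (1 : Ω → ℝ)) 2 P :=
  (memLp_const (1 : ℝ)).indicator hs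

/-- The first-order condition in the directions `1_A ⊕ 0` and `0 ⊕ 1_B` says that `(f ⊕ g - c)₊ dP`
has the marginals `μ` and `ν`. -/
theorem IsDualSolution.isCouplingDensity (hμ : IsReference μ μ₀) (hν : IsReference ν ν₀)
    (hc : MemLp c 2 (μ₀.prod ν₀)) (h : IsDualSolution μ μ₀ ν ν₀ c f g) :
    IsCouplingDensity μ μ₀ ν ν₀ c f g := by
  obtain ⟨hU, hfoc⟩ := h.first_order hμ hν hc
  have hUi := hU.integrable one_le_two
  rw [isCouplingDensity_iff]
  constructor
  · intro A hA
    have h1 := hfoc (A.indicator 1) (fun _ => 0)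
      ((integrable_const (1 : ℝ)).indicator hA) (integrable_zero _ _ _) (by
        simpa using! (memLp_indicator_one (P := μ₀) hA).comp_fst ν₀)
    rw [densityMeasure, withDensity_ofReal_apply hUi (posPartSum_nonneg c f g)
      (hA.prod MeasurableSet.univ)]
    have e : ∀ p : X × Y, (A ×ˢ Set.univ).indicator (1 : X × Y → ℝ) p =
        A.indicator 1 p.1 + 0 := by
      intro p
      by_cases hp : p.1 ∈ A <;> simp [hp, Set.indicator]
    simp only [e]
    rw [h1]
    simp [integral_indicator_one hA]
  · intro B hB
    have h1 := hfoc (fun _ => 0) (B.indicator 1) (integrable_zero _ _ _)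
      ((integrable_const (1 : ℝ)).indicator hB) (by
        simpa using! (memLp_indicator_one (P := ν₀) hB).comp_snd μ₀)
    rw [densityMeasure, withDensity_ofReal_apply hUi (posPartSum_nonneg c f g)
      (MeasurableSet.univ.prod hB)]
    have e : ∀ p : X × Y, (Set.univ ×ˢ B).indicator (1 : X × Y → ℝ) p =
        0 + B.indicator 1 p.2 := by
      intro p
      by_cases hp : p.2 ∈ B <;> simp [hp, Set.indicator]
    simp only [e]
    rw [h1]
    simp [integral_indicator_one hB]

/-! ### Coupling densities and the marginal system -/

/-- A measure with a density is a coupling exactly when integrating out either variable gives the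
density of the other marginal (Tonelli). -/
lemma withDensity_mem_couplings_iff (hμ : μ ≪ μ₀) (hν : ν ≪ ν₀) {h : X × Y → ℝ≥0∞}
    (hh : AEMeasurable h (μ₀.prod ν₀)) :
    (μ₀.prod ν₀).withDensity h ∈ couplings μ ν ↔
      (∀ᵐ y ∂ν₀, ∫⁻ x, h (x, y) ∂μ₀ = ν.rnDeriv ν₀ y) ∧
        ∀ᵐ x ∂μ₀, ∫⁻ y, h (x, y) ∂ν₀ = μ.rnDeriv μ₀ x := by
  have hX : ∀ A, MeasurableSet A → (μ₀.prod ν₀).withDensity h (A ×ˢ Set.univ) =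
      ∫⁻ x in A, ∫⁻ y, h (x, y) ∂ν₀ ∂μ₀ := by
    intro A hA
    rw [withDensity_apply _ (hA.prod MeasurableSet.univ), ← Measure.prod_restrict,
      Measure.restrict_univ, lintegral_prod]
    rw [← Measure.restrict_univ (μ := ν₀), Measure.prod_restrict]
    exact hh.restrict
  have hY : ∀ B, MeasurableSet B → (μ₀.prod ν₀).withDensity h (Set.univ ×ˢ B) =
      ∫⁻ y in B, ∫⁻ x, h (x, y) ∂μ₀ ∂ν₀ := by
    intro B hB
    rw [withDensity_apply _ (MeasurableSet.univ.prod hB), ← Measure.prod_restrict,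
      Measure.restrict_univ, lintegral_prod_symm]
    rw [← Measure.restrict_univ (μ := μ₀), Measure.prod_restrict]
    exact hh.restrict
  constructor
  · rintro ⟨h1, h2⟩
    constructor
    · refine ae_eq_of_forall_setLIntegral_eq_of_sigmaFinite₀ hh.lintegral_prod_left'
        (Measure.measurable_rnDeriv _ _).aemeasurable fun B hB _ => ?_
      rw [← hY B hB, h2 B hB, Measure.setLIntegral_rnDeriv hν]
    · refine ae_eq_of_forall_setLIntegral_eq_of_sigmaFinite₀ hh.lintegral_prod_right'
        (Measure.measurable_rnDeriv _ _).aemeasurable fun A hA _ => ?_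
      rw [← hX A hA, h1 A hA, Measure.setLIntegral_rnDeriv hμ]
  · rintro ⟨h1, h2⟩
    constructor
    · intro A hA
      rw [hX A hA, lintegral_congr_ae (ae_restrict_of_ae h2), Measure.setLIntegral_rnDeriv hμ]
    · intro B hB
      rw [hY B hB, lintegral_congr_ae (ae_restrict_of_ae h1), Measure.setLIntegral_rnDeriv hν]

lemma isCouplingDensity_iff_solvesMarginalSystem (hμ : μ ≪ μ₀) (hν : ν ≪ ν₀)
    (hU : AEMeasurable (posPartSum c f g) (μ₀.prod ν₀)) :
    IsCouplingDensity μ μ₀ ν ν₀ c f g ↔ SolvesMarginalSystem μ μ₀ ν ν₀ c f g := by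
  rw [isCouplingDensity_iff]
  exact withDensity_mem_couplings_iff hμ hν hU.ennreal_ofReal

end Marginals

/-! ### Integrability of potentials -/

section Integrability

variable {X Y : Type*} [MeasurableSpace X] [MeasurableSpace Y]
  {μ₀ : Measure X} {ν₀ : Measure Y} {c : X × Y → ℝ} {f : X → ℝ} {g : Y → ℝ}
  [IsProbabilityMeasure μ₀] [IsProbabilityMeasure ν₀]

/-- If the second marginal density of `(f ⊕ g - c)₊` is square-integrable, then so is `g₊`:
integrate `g ≤ (f ⊕ g - c)₊ + c - f` against the weight `1 / (1 + |f|)`, for which no integrability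
of `f` is needed. -/
lemma memLp_posPart_of_marginal (hc : MemLp c 2 (μ₀.prod ν₀)) (hf : Measurable f)
    (hg : Measurable g) {b : Y → ℝ} (hb : MemLp b 2 ν₀)
    (h : ∀ᵐ y ∂ν₀, Integrable (fun x => posPartSum c f g (x, y)) μ₀ ∧
      ∫ x, posPartSum c f g (x, y) ∂μ₀ = b y) :
    MemLp (fun y => max (g y) 0) 2 ν₀ := by
  set w : X → ℝ := fun x => 1 / (1 + |f x|) with hw
  have hw0 : ∀ x, 0 < w x := fun x => by positivity
  have hw1 : ∀ x, w x ≤ 1 := fun x => by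
    rw [hw, div_le_one (by positivity)]; linarith [abs_nonneg (f x)]
  have hwf : ∀ x, w x * |f x| ≤ 1 := fun x => by
    rw [hw, one_div_mul_eq_div, div_le_one (by positivity)]; linarith
  have hwm : Measurable w := measurable_const.div (measurable_const.add hf.abs)
  have hwi : Integrable w μ₀ := (integrable_const (1 : ℝ)).mono' hwm.aestronglyMeasurable
    (Eventually.of_forall fun x => by rw [Real.norm_of_nonneg (hw0 x).le]; exact hw1 x)
  have hκ : 0 < ∫ x, w x ∂μ₀ := by
    rw [integral_pos_iff_support_of_nonneg (fun x => (hw0 x).le) hwi]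
    have : Function.support w = Set.univ := Set.eq_univ_of_forall fun x => (hw0 x).ne'
    simp [this]
  set κ := ∫ x, w x ∂μ₀
  have hS : Integrable (fun y => ∫ x, c (x, y) ^ 2 ∂μ₀) ν₀ := hc.integrable_sq.integral_prod_right
  have hgm : Measurable fun y => max (g y) 0 := hg.max measurable_const
  rw [memLp_two_iff_integrable_sq hgm.aestronglyMeasurable]
  have hB := (((integrable_const (1 : ℝ)).add hS).add hb.integrable_sq).const_mul (3 / κ ^ 2)
  refine hB.mono' (hgm.pow_const 2).aestronglyMeasurable ?_
  filter_upwards [h, (hc.integrable one_le_two).prod_left_ae, hc.integrable_sq.prod_left_ae]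
    with y ⟨hUi, hUb⟩ hci hc2
  rw [Real.norm_of_nonneg (sq_nonneg _)]
  simp only [Pi.add_apply]
  set C := ∫ x, |c (x, y)| ∂μ₀ with hC
  have hC0 : 0 ≤ C := integral_nonneg fun _ => abs_nonneg _
  have hb0 : 0 ≤ b y := hUb ▸ integral_nonneg fun _ => posPartSum_nonneg _ _ _ _
  -- Jensen's inequality, from `2 C |c| ≤ c² + C²`
  have hCS : C ^ 2 ≤ ∫ x, c (x, y) ^ 2 ∂μ₀ := by
    have h1 : ∫ x, 2 * C * |c (x, y)| ∂μ₀ ≤ ∫ x, (c (x, y) ^ 2 + C ^ 2) ∂μ₀ := by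
      refine integral_mono (hci.abs.const_mul _) (hc2.add (integrable_const _)) fun x => ?_
      have := sq_nonneg (|c (x, y)| - C)
      rw [sub_sq, sq_abs] at this
      linarith
    rw [integral_const_mul, integral_add hc2 (integrable_const _)] at h1
    simp only [integral_const, probReal_univ, one_smul] at h1
    nlinarith
  have hgb : κ * max (g y) 0 ≤ 1 + C + b y := by
    rcases le_total (g y) 0 with hy | hy
    · rw [max_eq_right hy]; linarith
    rw [max_eq_left hy]
    have h1 : ∫ x, w x * g y ∂μ₀ ≤ ∫ x, (1 + |c (x, y)| + posPartSum c f g (x, y)) ∂μ₀ := by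
      refine integral_mono (hwi.mul_const _)
        (((integrable_const (1 : ℝ)).add hci.abs).add hUi) fun x => ?_
      have h2 : g y ≤ posPartSum c f g (x, y) + |c (x, y)| + |f x| := by
        have := le_max_left (f x + g y - c (x, y)) 0
        have := le_abs_self (c (x, y))
        have := neg_abs_le (f x)
        simp only [posPartSum]
        linarith
      have hU0 := posPartSum_nonneg c f g (x, y)
      calc w x * g y ≤ w x * (posPartSum c f g (x, y) + |c (x, y)| + |f x|) :=
            mul_le_mul_of_nonneg_left h2 (hw0 x).le
        _ = w x * (posPartSum c f g (x, y) + |c (x, y)|) + w x * |f x| := by ring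
        _ ≤ 1 * (posPartSum c f g (x, y) + |c (x, y)|) + 1 :=
            add_le_add (mul_le_mul_of_nonneg_right (hw1 x) (by positivity)) (hwf x)
        _ = _ := by ring
    have hci' : Integrable (fun x => 1 + |c (x, y)|) μ₀ := (integrable_const (1 : ℝ)).add hci.abs
    rw [integral_mul_const, integral_add hci' hUi,
      integral_add (integrable_const _) hci.abs, hUb] at h1
    simpa using h1
  have hg0 : 0 ≤ max (g y) 0 := le_max_right _ _
  have h3 : (κ * max (g y) 0) ^ 2 ≤ (1 + C + b y) ^ 2 := by gcongr
  have h4 : (1 + C + b y) ^ 2 ≤ 3 * (1 + C ^ 2 + b y ^ 2) := by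
    nlinarith [sq_nonneg (1 - C), sq_nonneg (1 - b y), sq_nonneg (C - b y)]
  rw [div_mul_eq_mul_div, le_div_iff₀ (by positivity)]
  nlinarith

lemma posPartSum_swap {X Y : Type*} (c : X × Y → ℝ) (f : X → ℝ) (g : Y → ℝ) (p : Y × X) :
    posPartSum (fun q => c q.swap) g f p = posPartSum c f g p.swap := by
  simp only [posPartSum, Prod.fst_swap, Prod.snd_swap, add_comm]

/-- If `U = (f ⊕ g - c)₊` is a coupling density, then `U ∈ L²(P)` and `f`, `g` are integrable. The
positive parts of `f` and `g` are bounded through the marginals of `U`; the negative parts are then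
integrable because `f ⊕ g` is integrable under the coupling `U dP`. -/
theorem IsCouplingDensity.integrability {μ : Measure X} {ν : Measure Y}
    [IsProbabilityMeasure μ] [IsProbabilityMeasure ν] (hμ : IsReference μ μ₀)
    (hν : IsReference ν ν₀) (hc : MemLp c 2 (μ₀.prod ν₀)) (hf : Measurable f)
    (hg : Measurable g) (h : IsCouplingDensity μ μ₀ ν ν₀ c f g) :
    MemLp (posPartSum c f g) 2 (μ₀.prod ν₀) ∧ Integrable f μ ∧ Integrable g ν := by
  have hUm := aestronglyMeasurable_posPartSum hc.1 hf.aestronglyMeasurable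
    (μ₀ := μ₀) (ν₀ := ν₀) hg.aestronglyMeasurable
  obtain ⟨hY, hX⟩ := (isCouplingDensity_iff_solvesMarginalSystem hμ.ac hν.ac hUm.aemeasurable).1 h
  rw [isCouplingDensity_iff] at h
  set P := μ₀.prod ν₀ with hP
  set U := posPartSum c f g with hU
  have hU0 : ∀ p, 0 ≤ U p := posPartSum_nonneg c f g
  have hUi : Integrable U P := by
    refine ⟨hUm, ?_⟩
    rw [hasFiniteIntegral_iff_ofReal (Eventually.of_forall hU0)]
    have := h.1 Set.univ MeasurableSet.univ
    rw [Set.univ_prod_univ, densityMeasure, withDensity_apply _ MeasurableSet.univ,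
      Measure.restrict_univ] at this
    rw [this]
    exact measure_lt_top _ _
  have hgp : MemLp (fun y => max (g y) 0) 2 ν₀ := by
    refine memLp_posPart_of_marginal hc hf hg hν.density_memLp ?_
    filter_upwards [hY, hUi.prod_left_ae] with y hy hi
    refine ⟨hi, ?_⟩
    rw [← hy, integral_eq_lintegral_of_nonneg_ae (Eventually.of_forall fun x => hU0 _) hi.1]
  have hfp : MemLp (fun x => max (f x) 0) 2 μ₀ := by
    have hc' : MemLp (fun q : Y × X => c q.swap) 2 (ν₀.prod μ₀) :=
      hc.comp_measurePreserving Measure.measurePreserving_swap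
    refine memLp_posPart_of_marginal hc' hg hf hμ.density_memLp ?_
    filter_upwards [hX, hUi.prod_right_ae] with x hx hi
    simp only [posPartSum_swap, Prod.swap_prod_mk]
    refine ⟨hi, ?_⟩
    rw [← hx, integral_eq_lintegral_of_nonneg_ae (Eventually.of_forall fun y => hU0 _) hi.1]
  have hU2 : MemLp U 2 P := by
    have hsum := ((hfp.comp_fst ν₀).add (hgp.comp_snd μ₀)).add hc.norm
    refine hsum.mono hUm (Eventually.of_forall fun p => ?_)
    simp only [Pi.add_apply]
    have h1 := le_max_right (f p.1) 0
    have h2 := le_max_right (g p.2) 0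
    rw [Real.norm_of_nonneg (hU0 p), Real.norm_of_nonneg (by positivity)]
    apply max_le
    · linarith [le_max_left (f p.1) 0, le_max_left (g p.2) 0, neg_abs_le (c p),
        Real.norm_eq_abs (c p)]
    · positivity
  have hfpμ : Integrable (fun x => max (f x) 0) μ := by
    rw [← integrable_rnDeriv_smul_iff hμ.ac]
    exact hμ.density_memLp.integrable_mul hfp
  have hgpν : Integrable (fun y => max (g y) 0) ν := by
    rw [← integrable_rnDeriv_smul_iff hν.ac]
    exact hν.density_memLp.integrable_mul hgp
  -- `f ⊕ g` is integrable for the coupling with density `U`, as `(f ⊕ g) U = U² + c U`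
  have hfg : Integrable (fun p => f p.1 + g p.2) (densityMeasure μ₀ ν₀ U) := by
    rw [integrable_densityMeasure_iff hUm.aemeasurable (Eventually.of_forall hU0)]
    refine (hU2.integrable_sq.add (hc.integrable_mul hU2)).congr (Eventually.of_forall fun p => ?_)
    simp only [Pi.add_apply, Pi.mul_apply, hU, posPartSum]
    rcases le_total (f p.1 + g p.2 - c p) 0 with hp | hp
    · rw [max_eq_right hp]; ring
    · rw [max_eq_left hp]; ring
  have hfgp := ((integrable_comp_fst_iff h hfpμ.1).2 hfpμ).add
    ((integrable_comp_snd_iff h hgpν.1).2 hgpν)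
  have hneg := hfgp.sub hfg
  have hpm : ∀ t : ℝ, t = max t 0 - max (-t) 0 := by
    intro t
    rcases le_total t 0 with ht | ht
    · rw [max_eq_right ht, max_eq_left (by linarith)]; ring
    · rw [max_eq_left ht, max_eq_right (by linarith)]; ring
  have hfn : Integrable (fun x => max (-f x) 0) μ := by
    have hm : Measurable fun x => max (-f x) 0 := hf.neg.max measurable_const
    rw [← integrable_comp_fst_iff h hm.aestronglyMeasurable]
    refine hneg.mono' (hm.comp measurable_fst).aestronglyMeasurable
      (Eventually.of_forall fun p => ?_)
    rw [Real.norm_of_nonneg (le_max_right _ _)]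
    simp only [Pi.sub_apply, Pi.add_apply]
    linarith [hpm (f p.1), hpm (g p.2), le_max_right (-g p.2) 0]
  have hgn : Integrable (fun y => max (-g y) 0) ν := by
    have hm : Measurable fun y => max (-g y) 0 := hg.neg.max measurable_const
    rw [← integrable_comp_snd_iff h hm.aestronglyMeasurable]
    refine hneg.mono' (hm.comp measurable_snd).aestronglyMeasurable
      (Eventually.of_forall fun p => ?_)
    rw [Real.norm_of_nonneg (le_max_right _ _)]
    simp only [Pi.sub_apply, Pi.add_apply]
    linarith [hpm (f p.1), hpm (g p.2), le_max_right (-f p.1) 0]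
  exact ⟨hU2, (hfpμ.sub hfn).congr (Eventually.of_forall fun x => (hpm (f x)).symm),
    (hgpν.sub hgn).congr (Eventually.of_forall fun y => (hpm (g y)).symm)⟩

end Integrability

/-! ### The regularized transport problem -/

section Transport

variable {X Y : Type*} [MeasurableSpace X] [MeasurableSpace Y]
  {μ μ₀ : Measure X} {ν ν₀ : Measure Y} {c : X × Y → ℝ}

lemma toLp_mem_couplingDensities {U : X × Y → ℝ} (hU : MemLp U 2 (μ₀.prod ν₀))
    (h0 : ∀ᵐ p ∂μ₀.prod ν₀, 0 ≤ U p) (h : densityMeasure μ₀ ν₀ U ∈ couplings μ ν) :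
    hU.toLp U ∈ couplingDensities μ μ₀ ν ν₀ := by
  refine ⟨?_, ?_⟩
  · filter_upwards [hU.coeFn_toLp, h0] with p hp hp0
    rwa [hp]
  · rwa [densityMeasure_congr hU.coeFn_toLp]

lemma extIntegral_eq_coe {π : Measure (X × Y)} (h : Integrable c π) :
    extIntegral c π = ((∫ p, c p ∂π : ℝ) : EReal) := by
  have h1 : ∫⁻ p, ENNReal.ofReal (c p) ∂π ≠ ∞ := h.lintegral_lt_top.ne
  have h2 : ∫⁻ p, ENNReal.ofReal (-c p) ∂π ≠ ∞ := h.neg.lintegral_lt_top.ne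
  rw [extIntegral, integral_eq_lintegral_pos_part_sub_lintegral_neg_part h, EReal.coe_sub,
    EReal.coe_ennreal_toReal h1, EReal.coe_ennreal_toReal h2]

lemma extIntegral_ne_bot {π : Measure (X × Y)} {h : X × Y → ℝ} (hh : Integrable h π)
    (hle : ∀ᵐ p ∂π, h p ≤ c p) : extIntegral c π ≠ ⊥ := by
  have h2 : ∫⁻ p, ENNReal.ofReal (-c p) ∂π ≠ ∞ := by
    refine ne_top_of_le_ne_top hh.neg.lintegral_lt_top.ne (lintegral_mono_ae ?_)
    filter_upwards [hle] with p hp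
    exact ENNReal.ofReal_le_ofReal (neg_le_neg hp)
  rw [extIntegral, ← EReal.coe_ennreal_toReal h2, sub_eq_add_neg, ← EReal.coe_neg]
  simp

variable [IsProbabilityMeasure μ₀] [IsProbabilityMeasure ν₀]

lemma qotCost_densityMeasure (hc : MemLp c 2 (μ₀.prod ν₀)) {Z : Lp ℝ 2 (μ₀.prod ν₀)}
    (h0 : ∀ᵐ p ∂μ₀.prod ν₀, 0 ≤ Z p) :
    qotCost μ₀ ν₀ c (densityMeasure μ₀ ν₀ Z) = (primalObj μ₀ ν₀ c Z : EReal) := by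
  have hZm := (Lp.aestronglyMeasurable Z).aemeasurable
  have hi : Integrable c (densityMeasure μ₀ ν₀ Z) :=
    (integrable_densityMeasure_iff hZm h0).2 (hc.integrable_mul (Lp.memLp Z))
  have hsq : ∫⁻ p, ((densityMeasure μ₀ ν₀ Z).rnDeriv (μ₀.prod ν₀) p) ^ 2 ∂(μ₀.prod ν₀) =
      ENNReal.ofReal (‖Z‖ ^ 2) := by
    have e : ‖Z‖ ^ 2 = ∫ p, Z p ^ 2 ∂(μ₀.prod ν₀) := by
      rw [← real_inner_self_eq_norm_sq, L2.inner_def]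
      simp only [Real.inner_apply, sq]
    rw [e, ofReal_integral_eq_lintegral_ofReal (Lp.memLp Z).integrable_sq
      (Eventually.of_forall fun _ => sq_nonneg _)]
    apply lintegral_congr_ae
    filter_upwards [Measure.rnDeriv_withDensity₀ (μ₀.prod ν₀) hZm.ennreal_ofReal, h0] with p hp hp0
    rw [densityMeasure, hp, ENNReal.ofReal_pow hp0]
  rw [qotCost, if_pos (c := densityMeasure μ₀ ν₀ Z ≪ _)
    (withDensity_absolutelyContinuous _ _), extIntegral_eq_coe hi, hsq,
    coe_half_mul_ofReal (sq_nonneg _), integral_densityMeasure hZm h0, ← EReal.coe_add, primalObj]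

variable [IsProbabilityMeasure μ]

/-- A coupling has infinite cost unless it has a square-integrable density. -/
lemma qotCost_eq_top_or (hc : IsCost μ μ₀ ν ν₀ c) {π : Measure (X × Y)}
    (hπ : π ∈ couplings μ ν) : qotCost μ₀ ν₀ c π = ⊤ ∨
      ∃ Z ∈ couplingDensities μ μ₀ ν ν₀, π = densityMeasure μ₀ ν₀ Z := by
  have := isProbabilityMeasure_of_mem_couplings hπ
  by_cases hac : π ≪ μ₀.prod ν₀
  swap
  · exact Or.inl (if_neg hac)
  by_cases hfin : ∫⁻ p, (π.rnDeriv (μ₀.prod ν₀) p) ^ 2 ∂(μ₀.prod ν₀) = ∞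
  · left
    -- the lower bound on `c` keeps `∫ c dπ` away from `-∞`
    obtain ⟨c₁, c₂, h1, -, h2, -, hle⟩ := hc.lower_bound
    have hi := ((integrable_comp_fst_iff hπ h1.1).2 h1).add
      ((integrable_comp_snd_iff hπ h2.1).2 h2)
    have hbot := extIntegral_ne_bot hi (hac.ae_le hle)
    rw [qotCost, if_pos hac, hfin, ENNReal.mul_top (by simp), EReal.coe_ennreal_top,
      EReal.add_top_of_ne_bot hbot]
  · right
    set Z : X × Y → ℝ := fun p => (π.rnDeriv (μ₀.prod ν₀) p).toReal with hZ
    have hZm : Measurable Z := (Measure.measurable_rnDeriv _ _).ennreal_toReal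
    have hof : ∀ᵐ p ∂μ₀.prod ν₀, ENNReal.ofReal (Z p) = π.rnDeriv (μ₀.prod ν₀) p := by
      filter_upwards [Measure.rnDeriv_lt_top π (μ₀.prod ν₀)] with p hp
      exact ENNReal.ofReal_toReal hp.ne
    have hZL : MemLp Z 2 (μ₀.prod ν₀) := by
      rw [memLp_two_iff_integrable_sq hZm.aestronglyMeasurable]
      refine ⟨(hZm.pow_const 2).aestronglyMeasurable, ?_⟩
      rw [hasFiniteIntegral_iff_ofReal (Eventually.of_forall fun _ => sq_nonneg _),
        lt_top_iff_ne_top]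
      convert hfin using 1
      apply lintegral_congr_ae
      filter_upwards [hof] with p hp
      rw [ENNReal.ofReal_pow ENNReal.toReal_nonneg, hp]
    have hd : densityMeasure μ₀ ν₀ Z = π := by
      rw [densityMeasure, withDensity_congr_ae hof, Measure.withDensity_rnDeriv_eq _ _ hac]
    refine ⟨hZL.toLp Z, toLp_mem_couplingDensities hZL
      (Eventually.of_forall fun _ => ENNReal.toReal_nonneg) (hd ▸ hπ), ?_⟩
    rw [densityMeasure_congr hZL.coeFn_toLp, hd]

lemma isQOTSolution_iff (hc : IsCost μ μ₀ ν ν₀ c) {Zs : Lp ℝ 2 (μ₀.prod ν₀)}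
    (h : ∀ Z, IsPrimalSolution μ μ₀ ν ν₀ c Z ↔ Z = Zs) (π : Measure (X × Y)) :
    IsQOTSolution μ μ₀ ν ν₀ c π ↔ π = densityMeasure μ₀ ν₀ Zs := by
  obtain ⟨hZs, hmin⟩ := (h Zs).2 rfl
  constructor
  · rintro ⟨hπ, hπmin⟩
    rcases qotCost_eq_top_or hc hπ with htop | ⟨Z, hZ, rfl⟩
    · have h1 := hπmin _ hZs.2
      rw [htop, top_le_iff, qotCost_densityMeasure hc.memLp hZs.1] at h1
      exact absurd h1 (EReal.coe_ne_top _)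
    · suffices Z = Zs by rw [this]
      refine (h Z).1 ⟨hZ, fun Z' hZ' => ?_⟩
      have h1 := hπmin _ hZ'.2
      rwa [qotCost_densityMeasure hc.memLp hZ.1, qotCost_densityMeasure hc.memLp hZ'.1,
        EReal.coe_le_coe_iff] at h1
  · rintro rfl
    refine ⟨hZs.2, fun π' hπ' => ?_⟩
    rcases qotCost_eq_top_or hc hπ' with htop | ⟨Z, hZ, rfl⟩
    · rw [htop]; exact le_top
    · rw [qotCost_densityMeasure hc.memLp hZs.1, qotCost_densityMeasure hc.memLp hZ.1,
        EReal.coe_le_coe_iff]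
      exact hmin Z hZ

end Transport

/-! ### The variational inequality and the primal problem -/

section Primal

variable {X Y : Type*} [MeasurableSpace X] [MeasurableSpace Y]
  {μ μ₀ : Measure X} {ν ν₀ : Measure Y} {c : X × Y → ℝ} {f : X → ℝ} {g : Y → ℝ}

lemma primalObj_eq_inner (hc : MemLp c 2 (μ₀.prod ν₀)) (Z : Lp ℝ 2 (μ₀.prod ν₀)) :
    primalObj μ₀ ν₀ c Z = inner ℝ (hc.toLp c) Z + 1 / 2 * ‖Z‖ ^ 2 := by
  rw [primalObj, L2.inner_def]
  congr 1
  apply integral_congr_ae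
  filter_upwards [hc.coeFn_toLp] with p hp
  rw [hp, Real.inner_apply]

/-- Expansion of the primal functional around `Z`. -/
lemma primalObj_expand (hc : MemLp c 2 (μ₀.prod ν₀)) (Z Z' : Lp ℝ 2 (μ₀.prod ν₀)) :
    primalObj μ₀ ν₀ c Z' = primalObj μ₀ ν₀ c Z + inner ℝ (Z + hc.toLp c) (Z' - Z)
      + 1 / 2 * ‖Z' - Z‖ ^ 2 := by
  simp only [primalObj_eq_inner hc, ← real_inner_self_eq_norm_sq, inner_add_left, inner_sub_left,
    inner_sub_right, real_inner_comm Z' Z]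
  ring

lemma norm_add_sq_eq_primalObj (hc : MemLp c 2 (μ₀.prod ν₀)) (Z : Lp ℝ 2 (μ₀.prod ν₀)) :
    ‖Z + hc.toLp c‖ ^ 2 = 2 * primalObj μ₀ ν₀ c Z + ‖hc.toLp c‖ ^ 2 := by
  rw [primalObj_eq_inner hc, norm_add_sq_real, real_inner_comm]
  ring

/-- The coupling density `Z` satisfies the variational inequality `⟪Z + C, Z' - Z⟫ ≥ 0` for all
coupling densities `Z'`; here `C` is the class of the cost in `L²(P)`. -/
def SolvesVariationalInequality (μ μ₀ : Measure X) (ν ν₀ : Measure Y) (C : Lp ℝ 2 (μ₀.prod ν₀))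
    (Z : Lp ℝ 2 (μ₀.prod ν₀)) : Prop :=
  Z ∈ couplingDensities μ μ₀ ν ν₀ ∧
    ∀ Z' ∈ couplingDensities μ μ₀ ν ν₀, 0 ≤ inner ℝ (Z + C) (Z' - Z)

lemma SolvesVariationalInequality.unique {C Z Z' : Lp ℝ 2 (μ₀.prod ν₀)}
    (h : SolvesVariationalInequality μ μ₀ ν ν₀ C Z)
    (h' : SolvesVariationalInequality μ μ₀ ν ν₀ C Z') : Z = Z' := by
  have h1 := h.2 Z' h'.1
  have h2 := h'.2 Z h.1
  have h3 : inner ℝ (Z + C) (Z' - Z) + inner ℝ (Z' + C) (Z - Z') = -‖Z - Z'‖ ^ 2 := by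
    simp only [← real_inner_self_eq_norm_sq, inner_add_left, inner_sub_left, inner_sub_right,
      real_inner_comm Z' Z]
    ring
  have h4 : ‖Z - Z'‖ ^ 2 = 0 := le_antisymm (by linarith) (sq_nonneg _)
  exact sub_eq_zero.1 (norm_eq_zero.1 (pow_eq_zero_iff two_ne_zero |>.1 h4))

lemma SolvesVariationalInequality.isPrimalSolution_iff {hc : MemLp c 2 (μ₀.prod ν₀)}
    {Zs Z : Lp ℝ 2 (μ₀.prod ν₀)}
    (h : SolvesVariationalInequality μ μ₀ ν ν₀ (hc.toLp c) Zs) :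
    IsPrimalSolution μ μ₀ ν ν₀ c Z ↔ Z = Zs := by
  constructor
  · rintro ⟨hZ, hmin⟩
    have h1 := hmin Zs h.1
    rw [primalObj_expand hc Zs Z] at h1
    have h2 := h.2 Z hZ
    have h4 : ‖Z - Zs‖ ^ 2 = 0 := le_antisymm (by linarith) (sq_nonneg _)
    exact sub_eq_zero.1 (norm_eq_zero.1 (pow_eq_zero_iff two_ne_zero |>.1 h4))
  · rintro rfl
    refine ⟨h.1, fun Z' hZ' => ?_⟩
    rw [primalObj_expand hc Z Z']
    linarith [h.2 Z' hZ', sq_nonneg ‖Z' - Z‖]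

lemma IsDualSolution.dualValue_eq (h : IsDualSolution μ μ₀ ν ν₀ c f g) :
    dualValue μ μ₀ ν ν₀ c = dualObj μ μ₀ ν ν₀ c f g := by
  apply le_antisymm
  · exact iSup_le fun f' => iSup_le fun g' => iSup_le fun hf' => iSup_le fun hg' =>
      h.2.2 f' g' hf' hg'
  · exact le_iSup_of_le f (le_iSup_of_le g (le_iSup_of_le h.1 (le_iSup_of_le h.2.1 le_rfl)))

lemma IsPrimalSolution.primalValue_eq {Z : Lp ℝ 2 (μ₀.prod ν₀)}
    (h : IsPrimalSolution μ μ₀ ν ν₀ c Z) :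
    primalValue μ μ₀ ν ν₀ c = (primalObj μ₀ ν₀ c Z : EReal) := by
  apply le_antisymm
  · exact iInf₂_le Z h.1
  · exact le_iInf₂ fun Z' hZ' => EReal.coe_le_coe_iff.2 (h.2 Z' hZ')

variable [IsProbabilityMeasure μ] [IsProbabilityMeasure μ₀]
  [IsProbabilityMeasure ν] [IsProbabilityMeasure ν₀]

/-- If `U = (f ⊕ g - c)₊` is a coupling density, then it solves the variational inequality and
there is no duality gap: `U + c ≥ f ⊕ g`, with equality where `U > 0`, and `∫ (f ⊕ g) Z dP` is the
same for all coupling densities `Z`. -/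
theorem IsCouplingDensity.variational (hμ : IsReference μ μ₀) (hν : IsReference ν ν₀)
    (hc : MemLp c 2 (μ₀.prod ν₀)) (hf : Measurable f) (hg : Measurable g)
    (h : IsCouplingDensity μ μ₀ ν ν₀ c f g) :
    ∃ Z : Lp ℝ 2 (μ₀.prod ν₀), posPartSum c f g =ᵐ[μ₀.prod ν₀] Z ∧
      SolvesVariationalInequality μ μ₀ ν ν₀ (hc.toLp c) Z ∧
      dualObj μ μ₀ ν ν₀ c f g = (primalObj μ₀ ν₀ c Z : EReal) := by
  obtain ⟨hU, hfi, hgi⟩ := h.integrability hμ hν hc hf hg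
  have hcpl := isCouplingDensity_iff.1 h
  have hU0 : ∀ p, 0 ≤ posPartSum c f g p := posPartSum_nonneg c f g
  obtain ⟨hWU, hWUv⟩ := integral_add_mul_density hU.1.aemeasurable (Eventually.of_forall hU0)
    hcpl hfi hgi
  have hUW : ∀ p, (posPartSum c f g p + c p) * posPartSum c f g p =
      (f p.1 + g p.2) * posPartSum c f g p := by
    intro p
    simp only [posPartSum]
    rcases le_total (f p.1 + g p.2 - c p) 0 with hp | hp
    · rw [max_eq_right hp]; ring
    · rw [max_eq_left hp]; ring
  have hcU : Integrable (fun p => c p * posPartSum c f g p) (μ₀.prod ν₀) := hc.integrable_mul hU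
  refine ⟨hU.toLp _, hU.coeFn_toLp.symm, ⟨toLp_mem_couplingDensities hU
    (Eventually.of_forall hU0) hcpl, fun Z' hZ' => ?_⟩, ?_⟩
  · obtain ⟨hWZ, hWZv⟩ := integral_add_mul_density (Lp.aestronglyMeasurable Z').aemeasurable
      hZ'.1 hZ'.2 hfi hgi
    rw [← sub_eq_zero_of_eq (hWZv.trans hWUv.symm), ← integral_sub hWZ hWU, L2.inner_def]
    refine integral_mono_ae (hWZ.sub hWU) (L2.integrable_inner _ _) ?_
    filter_upwards [Lp.coeFn_add (hU.toLp _) (hc.toLp c), Lp.coeFn_sub Z' (hU.toLp _),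
      hU.coeFn_toLp, hc.coeFn_toLp, hZ'.1] with p h1 h2 h3 h4 h5
    rw [h1, h2, Pi.add_apply, Pi.sub_apply, h3, h4, Real.inner_apply, mul_sub, hUW]
    have : f p.1 + g p.2 ≤ posPartSum c f g p + c p := by
      have := le_max_left (f p.1 + g p.2 - c p) 0
      simp only [posPartSum]
      linarith
    have := mul_le_mul_of_nonneg_right this h5
    linarith
  · rw [dualObj_eq_coe hU, EReal.coe_eq_coe_iff, ← hWUv, primalObj]
    have e1 : ∫ p, c p * (hU.toLp _ : X × Y → ℝ) p ∂(μ₀.prod ν₀) =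
        ∫ p, c p * posPartSum c f g p ∂(μ₀.prod ν₀) := by
      apply integral_congr_ae
      filter_upwards [hU.coeFn_toLp] with p hp
      rw [hp]
    have e2 : ‖hU.toLp _‖ ^ 2 = ∫ p, posPartSum c f g p ^ 2 ∂(μ₀.prod ν₀) := by
      rw [← real_inner_self_eq_norm_sq, L2.inner_def]
      apply integral_congr_ae
      filter_upwards [hU.coeFn_toLp] with p hp
      rw [hp, Real.inner_apply, sq]
    have e3 : ∫ p, (f p.1 + g p.2) * posPartSum c f g p ∂(μ₀.prod ν₀) =
        (∫ p, posPartSum c f g p ^ 2 ∂(μ₀.prod ν₀)) +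
          ∫ p, c p * posPartSum c f g p ∂(μ₀.prod ν₀) := by
      rw [← integral_add hU.integrable_sq hcU]
      refine integral_congr_ae (Eventually.of_forall fun p => ?_)
      simp only
      rw [← hUW p]; ring
    rw [e1, e2, e3]; ring

/-! ### Duality and potentials -/

/-- Existence of potentials together with the primal solution, without a duality gap. -/
theorem exists_potentials (hμ : IsReference μ μ₀) (hν : IsReference ν ν₀)
    (hc : MemLp c 2 (μ₀.prod ν₀)) :
    ∃ (f : X → ℝ) (g : Y → ℝ) (Z : Lp ℝ 2 (μ₀.prod ν₀)), Measurable f ∧ Measurable g ∧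
      IsDualSolution μ μ₀ ν ν₀ c f g ∧
      SolvesVariationalInequality μ μ₀ ν ν₀ (hc.toLp c) Z ∧
      dualObj μ μ₀ ν ν₀ c f g = (primalObj μ₀ ν₀ c Z : EReal) := by
  obtain ⟨f, g, hf, hg, hfg⟩ := exists_isDualSolution hμ hν hc
  obtain ⟨Z, -, hZ, hval⟩ := (hfg.isCouplingDensity hμ hν hc).variational hμ hν hc hf hg
  exact ⟨f, g, Z, hf, hg, hfg, hZ, hval⟩

/-- All characterizations go through coupling densities: these solve the variational inequality,
which has only one solution, and close the duality gap. -/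
theorem tfae_potentials (hμ : IsReference μ μ₀) (hν : IsReference ν ν₀)
    (hc : MemLp c 2 (μ₀.prod ν₀)) (hf : Measurable f) (hg : Measurable g) :
    List.TFAE [IsOptimalDensity μ μ₀ ν ν₀ c f g, IsCouplingDensity μ μ₀ ν ν₀ c f g,
      IsDualSolution μ μ₀ ν ν₀ c f g, SolvesMarginalSystem μ μ₀ ν ν₀ c f g] := by
  obtain ⟨f₀, g₀, Zs, -, -, hfg₀, hZs, hval⟩ := exists_potentials hμ hν hc
  tfae_have 1 → 2 := by
    rintro ⟨Z, ⟨hZ, -⟩, hUZ⟩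
    rw [isCouplingDensity_iff, densityMeasure_congr hUZ]
    exact hZ.2
  tfae_have 2 → 1 := fun h => by
    obtain ⟨Z, hUZ, hZ, -⟩ := h.variational hμ hν hc hf hg
    exact ⟨Z, hZ.isPrimalSolution_iff.2 rfl, hUZ⟩
  tfae_have 2 → 3 := fun h => by
    obtain ⟨Z, -, hZ, hval'⟩ := h.variational hμ hν hc hf hg
    obtain ⟨-, hfi, hgi⟩ := h.integrability hμ hν hc hf hg
    refine ⟨hfi, hgi, fun f' g' hf' hg' => (hfg₀.2.2 f' g' hf' hg').trans_eq ?_⟩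
    rw [hval, hval', hZ.unique hZs]
  tfae_have 3 → 2 := fun h => h.isCouplingDensity hμ hν hc
  tfae_have 2 ↔ 4 := isCouplingDensity_iff_solvesMarginalSystem hμ.ac hν.ac
    (aestronglyMeasurable_posPartSum hc.1 hf.aestronglyMeasurable
      hg.aestronglyMeasurable).aemeasurable
  tfae_finish

end Primal

/-! ### Self-transport -/

section SelfTransport

variable {X : Type*} [MeasurableSpace X] {μ μ₀ : Measure X} {c : X × X → ℝ} {f g : X → ℝ}
  [IsProbabilityMeasure μ₀]

lemma dualObj_swap (hsym : ∀ᵐ p ∂(μ₀.prod μ₀), c p = c p.swap) :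
    dualObj μ μ₀ μ μ₀ c f g = dualObj μ μ₀ μ μ₀ c g f := by
  unfold dualObj
  rw [add_comm (∫ x, f x ∂μ), ← lintegral_prod_swap]
  congr 3
  apply lintegral_congr_ae
  filter_upwards [hsym] with p hp
  simp only [posPartSum, Prod.fst_swap, Prod.snd_swap, ← hp, add_comm (f p.2)]

/-- By symmetry and concavity of the dual functional, the average of the two potentials is a
potential for both marginals. -/
lemma IsDualSolution.symmetrize (hμ : IsReference μ μ₀) (hc : MemLp c 2 (μ₀.prod μ₀))
    (hsym : ∀ᵐ p ∂(μ₀.prod μ₀), c p = c p.swap) (h : IsDualSolution μ μ₀ μ μ₀ c f g) :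
    IsDualSolution μ μ₀ μ μ₀ c (fun x => (f x + g x) / 2) fun x => (f x + g x) / 2 := by
  have hU := (h.first_order hμ hμ hc).1
  have h' : IsDualSolution μ μ₀ μ μ₀ c g f :=
    ⟨h.2.1, h.1, fun f' g' hf' hg' => by
      rw [dualObj_swap hsym, dualObj_swap (f := g) hsym]; exact h.2.2 g' f' hg' hf'⟩
  have hU' := (h'.first_order hμ hμ hc).1
  have hval := dualObj_swap (μ := μ) (f := f) (g := g) hsym
  obtain ⟨hf, hg, hmax⟩ := h
  have hF : Integrable (fun x => (f x + g x) / 2) μ := (hf.add hg).div_const 2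
  have e : (fun x => (g x + f x) / 2) = fun x => (f x + g x) / 2 := by
    ext x; rw [add_comm]
  have hV := memLp_posPartSum_midpoint hc.1 (hμ.aestronglyMeasurable hf.1)
    (hμ.aestronglyMeasurable hg.1) (hμ.aestronglyMeasurable hg.1)
    (hμ.aestronglyMeasurable hf.1) hU hU'
  have hle := posPartSum_midpoint_le c f g g f
  rw [e] at hV hle
  refine ⟨hF, hF, fun f' g' hf' hg' => (hmax f' g' hf' hg').trans ?_⟩
  rw [dualObj_eq_coe hU, dualObj_eq_coe hU', EReal.coe_eq_coe_iff] at hval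
  rw [dualObj_eq_coe hU, dualObj_eq_coe hV, EReal.coe_le_coe_iff, integral_div,
    integral_add hf hg]
  have hI : ∫ p, posPartSum c (fun x => (f x + g x) / 2) (fun x => (f x + g x) / 2) p ^ 2
      ∂(μ₀.prod μ₀) ≤ ((∫ p, posPartSum c f g p ^ 2 ∂(μ₀.prod μ₀)) +
        ∫ p, posPartSum c g f p ^ 2 ∂(μ₀.prod μ₀)) / 2 := by
    rw [← integral_add hU.integrable_sq hU'.integrable_sq, ← integral_div]
    refine integral_mono hV.integrable_sq
      ((hU.integrable_sq.add hU'.integrable_sq).div_const 2) fun p => ?_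
    have h1 : posPartSum c (fun x => (f x + g x) / 2) (fun x => (f x + g x) / 2) p ^ 2 ≤
        ((posPartSum c f g p + posPartSum c g f p) / 2) ^ 2 :=
      pow_le_pow_left₀ (posPartSum_nonneg _ _ _ _) (hle p) 2
    nlinarith [sq_nonneg (posPartSum c f g p - posPartSum c g f p)]
  linarith

end SelfTransport

end QuadOT

theorem theorem2p2 {X Y : Type*}
    [MeasurableSpace X] [MeasurableSpace.CountablyGenerated X]
    [MeasurableSpace Y] [MeasurableSpace.CountablyGenerated Y] :
    -- general marginals
    (∀ (μ μ₀ : Measure X) (ν ν₀ : Measure Y)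
      [IsProbabilityMeasure μ] [IsProbabilityMeasure μ₀]
      [IsProbabilityMeasure ν] [IsProbabilityMeasure ν₀]
      (c : X × Y → ℝ) (_ : QuadOT.IsReference μ μ₀) (_ : QuadOT.IsReference ν ν₀)
      (hc : QuadOT.IsCost μ μ₀ ν ν₀ c),
      -- strong duality, with a finite common value
      (QuadOT.primalValue μ μ₀ ν ν₀ c = QuadOT.dualValue μ μ₀ ν ν₀ c ∧
        ∃ v : ℝ, QuadOT.primalValue μ μ₀ ν ν₀ c = (v : EReal)) ∧
      -- the primal solution `Zs`
      (∃ Zs : Lp ℝ 2 (μ₀.prod ν₀),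
        -- it is the unique solution of the primal problem
        (∀ Z, QuadOT.IsPrimalSolution μ μ₀ ν ν₀ c Z ↔ Z = Zs) ∧
        -- it is the projection of `-c` onto the set of coupling densities
        (∀ Z, (Z ∈ QuadOT.couplingDensities μ μ₀ ν ν₀ ∧
            ∀ Z' ∈ QuadOT.couplingDensities μ μ₀ ν ν₀,
              ‖Z + hc.memLp.toLp c‖ ^ 2 ≤ ‖Z' + hc.memLp.toLp c‖ ^ 2) ↔ Z = Zs) ∧
        -- it is characterized by the variational inequality
        (∀ Z, (Z ∈ QuadOT.couplingDensities μ μ₀ ν ν₀ ∧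
            ∀ Z' ∈ QuadOT.couplingDensities μ μ₀ ν ν₀,
              0 ≤ inner ℝ (Z + hc.memLp.toLp c) (Z' - Z)) ↔ Z = Zs) ∧
        -- `Zs dP` is the unique solution of the regularized transport problem
        (∀ π, QuadOT.IsQOTSolution μ μ₀ ν ν₀ c π ↔ π = QuadOT.densityMeasure μ₀ ν₀ Zs)) ∧
      -- existence and characterizations of potentials
      (∃ (f : X → ℝ) (g : Y → ℝ), Measurable f ∧ Measurable g ∧
        QuadOT.IsOptimalDensity μ μ₀ ν ν₀ c f g ∧
        QuadOT.IsCouplingDensity μ μ₀ ν ν₀ c f g ∧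
        QuadOT.IsDualSolution μ μ₀ ν ν₀ c f g ∧
        QuadOT.SolvesMarginalSystem μ μ₀ ν ν₀ c f g) ∧
      (∀ (f : X → ℝ) (g : Y → ℝ), Measurable f → Measurable g →
        List.TFAE [
          QuadOT.IsOptimalDensity μ μ₀ ν ν₀ c f g,
          QuadOT.IsCouplingDensity μ μ₀ ν ν₀ c f g,
          QuadOT.IsDualSolution μ μ₀ ν ν₀ c f g,
          QuadOT.SolvesMarginalSystem μ μ₀ ν ν₀ c f g])) ∧
    -- self-transport
    (∀ (μ μ₀ : Measure X) [IsProbabilityMeasure μ] [IsProbabilityMeasure μ₀]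
      (c : X × X → ℝ) (_ : QuadOT.IsReference μ μ₀) (_ : QuadOT.IsCost μ μ₀ μ μ₀ c)
      (_ : ∀ᵐ p ∂(μ₀.prod μ₀), c p = c p.swap),
      (∃ f : X → ℝ, Measurable f ∧
        QuadOT.IsOptimalDensity μ μ₀ μ μ₀ c f f ∧
        QuadOT.IsCouplingDensity μ μ₀ μ μ₀ c f f ∧
        QuadOT.IsDualSolution μ μ₀ μ μ₀ c f f ∧
        QuadOT.SolvesMarginalSystem μ μ₀ μ μ₀ c f f) ∧
      QuadOT.dualValue μ μ₀ μ μ₀ c =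
        ⨆ (f : X → ℝ) (_ : Integrable f μ), QuadOT.dualObj μ μ₀ μ μ₀ c f f) := by
  refine ⟨?_, ?_⟩
  · intro μ μ₀ ν ν₀ _ _ _ _ c hμ hν hc
    obtain ⟨f, g, Zs, hf, hg, hfg, hZs, hval⟩ := QuadOT.exists_potentials hμ hν hc.memLp
    have hprim : ∀ Z, QuadOT.IsPrimalSolution μ μ₀ ν ν₀ c Z ↔ Z = Zs :=
      fun Z => hZs.isPrimalSolution_iff
    have hpv := ((hprim Zs).2 rfl).primalValue_eq
    have htfae := fun (f : X → ℝ) (g : Y → ℝ) (hf : Measurable f) (hg : Measurable g) =>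
      QuadOT.tfae_potentials hμ hν hc.memLp hf hg
    refine ⟨⟨by rw [hpv, hfg.dualValue_eq, hval], _, hpv⟩, ⟨Zs, hprim, fun Z => ?_, fun Z => ?_,
      QuadOT.isQOTSolution_iff hc hprim⟩, ⟨f, g, hf, hg, ?_, ?_, hfg, ?_⟩, htfae⟩
    · rw [← hprim Z]
      refine and_congr_right fun _ => forall₂_congr fun Z' _ => ?_
      rw [QuadOT.norm_add_sq_eq_primalObj, QuadOT.norm_add_sq_eq_primalObj]
      constructor <;> intro h <;> linarith
    · exact ⟨fun h => QuadOT.SolvesVariationalInequality.unique h hZs, fun h => h ▸ hZs⟩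
    · exact ((htfae f g hf hg).out 0 2).2 hfg
    · exact ((htfae f g hf hg).out 1 2).2 hfg
    · exact ((htfae f g hf hg).out 3 2).2 hfg
  · intro μ μ₀ _ _ c hμ hc hsym
    obtain ⟨f, g, hf, hg, hfg⟩ := QuadOT.exists_isDualSolution hμ hμ hc.memLp
    have hh := hfg.symmetrize hμ hc.memLp hsym
    have hm : Measurable fun x => (f x + g x) / 2 := (hf.add hg).div_const 2
    have htfae := QuadOT.tfae_potentials hμ hμ hc.memLp hm hm
    refine ⟨⟨_, hm, (htfae.out 0 2).2 hh, (htfae.out 1 2).2 hh, hh, (htfae.out 3 2).2 hh⟩, ?_⟩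
    apply le_antisymm
    · rw [hh.dualValue_eq]
      exact le_iSup_of_le _ (le_iSup_of_le hh.1 le_rfl)
    · exact iSup_le fun f' => iSup_le fun hf' =>
        le_iSup_of_le f' (le_iSup_of_le f' (le_iSup_of_le hf' (le_iSup_of_le hf' le_rfl)))
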